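/- Let $\mathbb{O}$ be the 8-dimensional complex algebra with basis $1,e_1,\dots,e_7$ and unit $1$ (the complex octonions), in which the triples $(e_i,e_j,e_k)$ with $ijk\in\{124,235,346,457,561,672,713\}$ are quaternionic, i.e. $e_i^2=e_j^2=e_k^2=(e_ie_j)e_k=-1$ (so that $e_ie_j=e_k=-e_je_i$, and likewise for the cyclic permutations of $ijk$). Let $V\subset\mathbb{O}$ be the span of $e_1,\dots,e_7$, let $\mathrm{Tr}:\mathbb{O}\to\mathbb{C}$ be the linear form with kernel $V$ and $\mathrm{Tr}(1)=1$, let $q\mapsto\bar q$ be the linear involution that fixes $1$ and is $-1$ on $V$, and put $n(q)=\mathrm{Tr}(q\bar q)$. For $a\in\mathbb{O}$ with $n(a)\neq 0$ put $a^{-1}=n(a)^{-1}\bar a$ and $T_a(q)=(aq)a^{-1}$. Let $G=G_2(\mathbb{C})$ be the group of algebra automorphisms of $\mathbb{O}$, a linear algebraic group acting on $V$ and, by conjugation, on itself. Let $\mathcal{O}=\{v\in V: n(v)=3\}$, and for $v\in\mathcal{O}$ let $a(v)=(1+v)/2$. Then $T_{a(v)}\in G$ for every $v\in\mathcal{O}$,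 and the map $\mathcal{O}\to G$, $v\mapsto T_{a(v)}$, is $G$-equivariant: if $g\in G$ and $v\in\mathcal{O}$, then $g(v)\in\mathcal{O}$ and $T_{a(g(v))}=g\,T_{a(v)}\,g^{-1}$. Moreover, $G$ has exactly one semisimple conjugacy class $\mathcal{C}$ of dimension six; $\mathcal{O}$ is Zariski closed in $V$ and $\mathcal{C}$ is Zariski closed in $\mathrm{End}(\mathbb{O})$; and $v\mapsto T_{a(v)}$ is an isomorphism of affine varieties of $\mathcal{O}$ onto $\mathcal{C}$. -/

import Mathlib

/-- The complex octonions, with `ℂ`-basis `1, e₁, …, e₇`. An element is a pair `(scalar part,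
coordinates on e₁, …, e₇)`; the indices of the `eₙ` are read modulo `7`. -/
def ComplexOctonion : Type := ℂ × (ZMod 7 → ℂ)

namespace ComplexOctonion

noncomputable section

instance : AddCommGroup ComplexOctonion := inferInstanceAs (AddCommGroup (ℂ × (ZMod 7 → ℂ)))

instance : Module ℂ ComplexOctonion := inferInstanceAs (Module ℂ (ℂ × (ZMod 7 → ℂ)))

/-- The coefficient of `1`. -/
def re (x : ComplexOctonion) : ℂ := x.1

/-- The coefficients of the `eₙ`. -/
def im (x : ComplexOctonion) : ZMod 7 → ℂ := x.2

@[ext] theorem ext {x y : ComplexOctonion} (h : x.re = y.re) (h' : ∀ k, x.im k = y.im k) :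
    x = y := Prod.ext h (funext h')

/-- The octonion with given coordinates. -/
def mk (a : ℂ) (u : ZMod 7 → ℂ) : ComplexOctonion := (a, u)

@[simp] theorem re_mk (a : ℂ) (u : ZMod 7 → ℂ) : (mk a u).re = a := rfl
@[simp] theorem im_mk (a : ℂ) (u : ZMod 7 → ℂ) : (mk a u).im = u := rfl
@[simp] theorem re_zero : (0 : ComplexOctonion).re = 0 := rfl
@[simp] theorem im_zero : (0 : ComplexOctonion).im = 0 := rfl
@[simp] theorem re_add (x y : ComplexOctonion) : (x + y).re = x.re + y.re := rfl
@[simp] theorem im_add (x y : ComplexOctonion) : (x + y).im = x.im + y.im := rfl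
@[simp] theorem re_smul (c : ℂ) (x : ComplexOctonion) : (c • x).re = c * x.re := rfl
@[simp] theorem im_smul (c : ℂ) (x : ComplexOctonion) : (c • x).im = c • x.im := rfl

instance : One ComplexOctonion := ⟨mk 1 0⟩

@[simp] theorem re_one : (1 : ComplexOctonion).re = 1 := rfl
@[simp] theorem im_one : (1 : ComplexOctonion).im = 0 := rfl

/-- The basis vector `eₙ`, with `n` read modulo `7`. -/
def e (n : ZMod 7) : ComplexOctonion := mk 0 (Pi.single n 1)

/-- The bilinear multiplication with unit `1` for which `(eₙ, eₙ₊₁, eₙ₊₃)` is a quaternionic triple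
for every `n` modulo `7`, so the oriented lines are `124, 235, 346, 457, 561, 672, 713`. The
products of two distinct basis vectors that are equal to `eₖ` are `eₖ₊₁ eₖ₊₃`, `eₖ₊₂ eₖ₊₆`,
`eₖ₊₄ eₖ₊₅`; in the opposite order they are `-eₖ`. -/
instance : Mul ComplexOctonion :=
  ⟨fun x y => mk (x.re * y.re - ∑ k, x.im k * y.im k)
    (fun k => x.re * y.im k + x.im k * y.re
      + (x.im (k + 1) * y.im (k + 3) - x.im (k + 3) * y.im (k + 1))
      + (x.im (k + 2) * y.im (k + 6) - x.im (k + 6) * y.im (k + 2))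
      + (x.im (k + 4) * y.im (k + 5) - x.im (k + 5) * y.im (k + 4)))⟩

theorem re_mul (x y : ComplexOctonion) :
    (x * y).re = x.re * y.re - ∑ k, x.im k * y.im k := rfl

theorem im_mul (x y : ComplexOctonion) (k : ZMod 7) :
    (x * y).im k = x.re * y.im k + x.im k * y.re
      + (x.im (k + 1) * y.im (k + 3) - x.im (k + 3) * y.im (k + 1))
      + (x.im (k + 2) * y.im (k + 6) - x.im (k + 6) * y.im (k + 2))
      + (x.im (k + 4) * y.im (k + 5) - x.im (k + 5) * y.im (k + 4)) := rfl

/-- The octonions form a (non-associative) ring with unit. -/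
instance : NonAssocRing ComplexOctonion :=
  { (inferInstance : AddCommGroup ComplexOctonion),
    (inferInstance : Mul ComplexOctonion),
    (inferInstance : One ComplexOctonion) with
    left_distrib := fun x y z => by
      ext
      · simp only [re_mul, re_add, im_add, Pi.add_apply, mul_add, Finset.sum_add_distrib]; ring
      · simp only [im_mul, re_add, im_add, Pi.add_apply]; ring
    right_distrib := fun x y z => by
      ext
      · simp only [re_mul, re_add, im_add, Pi.add_apply, add_mul, Finset.sum_add_distrib]; ring
      · simp only [im_mul, re_add, im_add, Pi.add_apply]; ring
    zero_mul := fun x => by ext <;> simp [re_mul, im_mul]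
    mul_zero := fun x => by ext <;> simp [re_mul, im_mul]
    one_mul := fun x => by ext <;> simp [re_mul, im_mul]
    mul_one := fun x => by ext <;> simp [re_mul, im_mul] }

instance : IsScalarTower ℂ ComplexOctonion ComplexOctonion :=
  ⟨fun c x y => by
    simp only [smul_eq_mul]
    ext
    · simp only [re_mul, re_smul, im_smul, Pi.smul_apply, smul_eq_mul, mul_sub, Finset.mul_sum,
        mul_assoc]
    · simp only [im_mul, re_smul, im_smul, Pi.smul_apply, smul_eq_mul]; ring⟩

instance : SMulCommClass ℂ ComplexOctonion ComplexOctonion :=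
  ⟨fun c x y => by
    simp only [smul_eq_mul]
    ext
    · simp only [re_mul, re_smul, im_smul, Pi.smul_apply, smul_eq_mul, mul_sub, Finset.mul_sum,
        mul_left_comm]
    · simp only [im_mul, re_smul, im_smul, Pi.smul_apply, smul_eq_mul]; ring⟩

theorem e_mul_self (n : ZMod 7) : e n * e n = -1 := by
  rw [eq_neg_iff_add_eq_zero]
  ext k
  · simp [re_mul, e, Pi.single_apply]
  · simp only [im_add, Pi.add_apply, im_mul, e, re_mk, im_mk, im_one, im_zero, Pi.zero_apply]
    ring

theorem e_mul_e_succ (n : ZMod 7) : e n * e (n + 1) = e (n + 3) := by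
  ext k
  · simp [re_mul, e, Pi.single_apply]
    decide
  · simp only [im_mul, e, re_mk, im_mk, Pi.single_apply]
    have h : ∀ n k : ZMod 7, (0 * (if k = n + 1 then (1 : ℤ) else 0) + (if k = n then 1 else 0) * 0
      + ((if k + 1 = n then 1 else 0) * (if k + 3 = n + 1 then 1 else 0)
        - (if k + 3 = n then 1 else 0) * (if k + 1 = n + 1 then 1 else 0))
      + ((if k + 2 = n then 1 else 0) * (if k + 6 = n + 1 then 1 else 0)
        - (if k + 6 = n then 1 else 0) * (if k + 2 = n + 1 then 1 else 0))
      + ((if k + 4 = n then 1 else 0) * (if k + 5 = n + 1 then 1 else 0)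
        - (if k + 5 = n then 1 else 0) * (if k + 4 = n + 1 then 1 else 0)))
      = if k = n + 3 then 1 else 0 := by decide
    have := congrArg (Int.cast : ℤ → ℂ) (h n k)
    push_cast at this
    exact this

/-- `Tr`: the linear form with `Tr 1 = 1` that vanishes on every `eₙ`. -/
def Tr : ComplexOctonion →ₗ[ℂ] ℂ where
  toFun := re
  map_add' := re_add
  map_smul' := re_smul

/-- The imaginary octonions, spanned by `e₁, …, e₇`. -/
def V : Submodule ℂ ComplexOctonion := LinearMap.ker Tr

/-- The involution that fixes `1` and is `-1` on the imaginary octonions. -/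
def conj (x : ComplexOctonion) : ComplexOctonion := mk x.re (-x.im)

/-- The symmetric bilinear form `⟨x, y⟩ = Tr (x ȳ)`. -/
def form (x y : ComplexOctonion) : ℂ := Tr (x * conj y)

/-- The norm `n(x) = ⟨x, x⟩`, a complex quadratic form. -/
def n (x : ComplexOctonion) : ℂ := form x x

/-- The inverse `x⁻¹ = x̄ / n(x)`, meaningful if `n(x) ≠ 0`, see `mul_inv_of_ne` and
`inv_mul_of_ne`. -/
instance : Inv ComplexOctonion := ⟨fun x => (n x)⁻¹ • conj x⟩

theorem inv_def (x : ComplexOctonion) : x⁻¹ = (n x)⁻¹ • conj x := rfl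

theorem mul_conj (x : ComplexOctonion) : x * conj x = n x • 1 := by
  ext k
  · simp [n, form, Tr]
  · simp [im_mul, conj]; ring

theorem conj_mul (x : ComplexOctonion) : conj x * x = n x • 1 := by
  ext k
  · simp [n, form, Tr, re_mul, conj]
  · simp [im_mul, conj]; ring

theorem mul_inv_of_ne {x : ComplexOctonion} (h : n x ≠ 0) : x * x⁻¹ = 1 := by
  rw [inv_def, mul_smul_comm, mul_conj, smul_smul, inv_mul_cancel₀ h, one_smul]

theorem inv_mul_of_ne {x : ComplexOctonion} (h : n x ≠ 0) : x⁻¹ * x = 1 := by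
  rw [inv_def, smul_mul_assoc, conj_mul, smul_smul, inv_mul_cancel₀ h, one_smul]

/-- Conjugation `T_a(q) = a q a⁻¹`. -/
def T (a q : ComplexOctonion) : ComplexOctonion := (a * q) * a⁻¹

/-- The octonion `a(v) = (1 + v) / 2`. -/
def a (v : ComplexOctonion) : ComplexOctonion := (1 / 2 : ℂ) • (1 + v)

/-- The quadric of imaginary octonions of norm `3`. -/
def quadric : Set V := {v | n v = 3}

/-- `G₂(ℂ)`, the group of algebra automorphisms of the complex octonions. -/
def G₂ : Subgroup (ComplexOctonion ≃ₗ[ℂ] ComplexOctonion) where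
  carrier := {g | ∀ x y, g (x * y) = g x * g y}
  mul_mem' := fun {g h} hg hh x y => by
    simp only [Set.mem_ofPred_eq] at hg hh
    simp only [LinearEquiv.mul_apply, hh, hg]
  one_mem' := fun _ _ => rfl
  inv_mem' := fun {g} hg x y => by
    apply g.injective
    have h : ∀ z, g (g⁻¹ z) = z := g.apply_symm_apply
    rw [hg, h, h, h]

/-- The inclusion of `G₂(ℂ)` in the vector space of endomorphisms of the octonions. -/
def toEnd (g : G₂) : Module.End ℂ ComplexOctonion :=
  (g : ComplexOctonion ≃ₗ[ℂ] ComplexOctonion).toLinearMap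

/-- A conjugacy class of `G₂(ℂ)`, as a subset of the space of endomorphisms. -/
def classVariety (C : ConjClasses G₂) : Set (Module.End ℂ ComplexOctonion) := toEnd '' C.carrier

/-- A conjugacy class is semisimple if its elements are semisimple (that is, diagonalizable)
linear maps. -/
def IsSemisimpleClass (C : ConjClasses G₂) : Prop := ∀ g ∈ C.carrier, (toEnd g).IsSemisimple

end

end ComplexOctonion

/-! ### Affine varieties in finite-dimensional complex vector spaces -/

namespace AffineVar

variable {W W' : Type*} [AddCommGroup W] [Module ℂ W] [AddCommGroup W'] [Module ℂ W']

/-- The polynomial functions on `W`: the algebra of functions generated by the linear forms. -/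
def polyFun (W : Type*) [AddCommGroup W] [Module ℂ W] : Subalgebra ℂ (W → ℂ) :=
  Algebra.adjoin ℂ (Set.range fun (l : Module.Dual ℂ W) (w : W) => l w)

/-- `X` is the common zero set of a set of polynomial functions. -/
def IsZariskiClosed (X : Set W) : Prop :=
  ∃ S : Set (W → ℂ), S ⊆ polyFun W ∧ X = {w | ∀ p ∈ S, p w = 0}

/-- The coordinate ring `ℂ[X]`: the restrictions to `X` of the polynomial functions on `W`. -/
def coordRing (X : Set W) : Subalgebra ℂ (X → ℂ) :=
  Algebra.adjoin ℂ (Set.range fun (l : Module.Dual ℂ W) (x : X) => l x)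

/-- The dimension of `X`, as the Krull dimension of its coordinate ring. (In general this is the
dimension of the Zariski closure of `X`, which is that of `X` if `X` is locally closed.) -/
noncomputable def dim (X : Set W) : WithBot ℕ∞ := ringKrullDim (coordRing X)

/-- A map of (closed) subvarieties is regular if it pulls regular functions back to regular
functions. -/
def IsRegular {X : Set W} {Y : Set W'} (f : X → Y) : Prop :=
  ∀ h ∈ coordRing Y, h ∘ f ∈ coordRing X

/-- An isomorphism of (closed) subvarieties: a bijection that is regular in both directions. -/
def IsIso {X : Set W} {Y : Set W'} (f : X ≃ Y) : Prop :=
  IsRegular f ∧ IsRegular f.symm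

end AffineVar

open ComplexOctonion AffineVar

open ComplexOctonion AffineVar

/-! ### Lower bounds for Krull dimensions -/

/-! For `v` imaginary of norm 3, the octonion a = a(v) has trace 1/2 and norm 1, so a² = a - 1: its
inverse is 1 - a, and a³ = -1. The Moufang laws then make T_a an automorphism (`conj_mul_conj`), of
order dividing three and hence semisimple. Explicitly T_a(q) = (1 + v)q(1 - v)/4 (`rot_apply`), an
expression quadratic in `v` and built from octonion operations alone; equivariance and regularity
follow. Its skew part for the bilinear form is q ↦ (vq - qv)/4, so `v` is a linear function of T_a
(`im_eq_rot`). The inverse map is therefore regular, and the image is cut out by polynomial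
equations.

The image is one conjugacy class because G₂ is transitive on the quadric (`exists_actQuadric_eq`);
the rotations T_{a(u)} already suffice to connect its points. Its dimension is that of a quadric
hypersurface in the 7-dimensional space V.

For uniqueness, a semisimple automorphism fixes a point of the quadric (`exists_fixed_quadric`), so
up to conjugacy it fixes e₀. In Zorn's vector matrices determinant-one matrices act by automorphisms
fixing e₀, and such an action diagonalizes the automorphism to diag(c₀, c₁, c₂) with c₀c₁c₂ = 1
(`exists_conj_diagMap`). If the three entries agree, it is the identity, whose class is a point, or
it is T_{a(v)} for a multiple `v` of e₀ (`rot_basePoint_apply`). Otherwise at least seven roots are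
nontrivial on it, and moving it by exponentials of the root derivations shows that its class has
dimension at least 7 (`seven_le_dim_classVariety`).

Analysis meets Krull dimension as follows: linear forms that map a set onto a neighbourhood of a
point are algebraically independent on that set, and the number of algebraically independent
elements bounds the dimension from below. -/

theorem ringKrullDim_le_of_isIntegral {R S : Type*} [CommRing R] [CommRing S] [IsDomain S]
    [Algebra R S] [Algebra.IsIntegral R S] (hinj : Function.Injective (algebraMap R S)) :
    ringKrullDim R ≤ ringKrullDim S := by
  refine iSup_le fun l => ?_
  -- Lying over supplies a prime above the bottom of the chain; going up lifts the rest of the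
  -- chain.
  obtain ⟨P, hP, hPl⟩ := Ideal.exists_ideal_over_prime_of_isIntegral_of_isDomain (S := S)
    l.head.asIdeal (by rw [(RingHom.injective_iff_ker_eq_bot _).1 hinj]; exact bot_le)
  have : P.LiesOver (RelSeries.head l).asIdeal := ⟨hPl.symm⟩
  obtain ⟨L, hL, -⟩ := Ideal.exists_ltSeries_of_hasGoingUp l P
  rw [← hL]
  exact le_iSup (fun L : LTSeries (PrimeSpectrum S) => (L.length : WithBot ℕ∞)) L

/-- Noether normalization makes `A` integral over a polynomial ring in `s` variables. Then `s`
bounds the transcendence degree from above and the Krull dimension from below. -/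
theorem AlgebraicIndependent.natCard_le_ringKrullDim_of_isDomain {k A ι : Type*} [Field k]
    [CommRing A] [IsDomain A] [Algebra k A] [Algebra.FiniteType k A] [Finite ι] {x : ι → A}
    (hx : AlgebraicIndependent k x) : (Nat.card ι : WithBot ℕ∞) ≤ ringKrullDim A := by
  obtain ⟨s, g, hg, hint⟩ := exists_integral_inj_algHom_of_fg k A
  let _ : Algebra (MvPolynomial (Fin s) k) A := g.toRingHom.toAlgebra
  have : Algebra.IsIntegral (MvPolynomial (Fin s) k) A := ⟨hint⟩
  have h1 : ringKrullDim (MvPolynomial (Fin s) k) ≤ ringKrullDim A :=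
    ringKrullDim_le_of_isIntegral hg
  rw [MvPolynomial.ringKrullDim_of_isNoetherianRing, ringKrullDim_eq_zero_of_field, zero_add,
    Nat.card_fin] at h1
  refine le_trans ?_ h1
  have hrange : g.range = Algebra.adjoin k (Set.range fun i => g (MvPolynomial.X i)) := by
    rw [← Algebra.map_top, ← MvPolynomial.adjoin_range_X, AlgHom.map_adjoin, ← Set.range_comp]
    rfl
  have halg : Algebra.IsAlgebraic
      (Algebra.adjoin k (Set.range fun i => g (MvPolynomial.X i))) A := by
    rw [← hrange]
    have : Algebra.IsIntegral g.range A := ⟨fun a => by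
      obtain ⟨p, hp, hpa⟩ := hint a
      refine ⟨p.map g.rangeRestrict.toRingHom, hp.map _, ?_⟩
      rw [Polynomial.eval₂_map]
      exact hpa⟩
    infer_instance
  have h2 := Algebra.IsAlgebraic.trdeg_le_cardinalMk k
    (Set.range fun i => g (MvPolynomial.X i : MvPolynomial (Fin s) k))
  have h3 := hx.lift_cardinalMk_le_trdeg
  have h4 : Cardinal.mk (Set.range fun i => g (MvPolynomial.X i : MvPolynomial (Fin s) k))
      ≤ s := by
    refine (Cardinal.mk_range_le_lift (f := fun i => g (MvPolynomial.X i : MvPolynomial (Fin s) k))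
      |> fun h => ?_)
    simpa using h
  have h5 := h3.trans (Cardinal.lift_le.2 (h2.trans h4))
  have := Fintype.ofFinite ι
  simp only [Cardinal.mk_fintype, Cardinal.lift_natCast, Nat.cast_le] at h5
  rw [Nat.card_eq_fintype_card]
  exact_mod_cast h5

/-- Reduction to a domain: the values at `x` of the nonzero polynomials form a multiplicative set
without 0, and modulo a prime that avoids this set the family stays independent. -/
theorem AlgebraicIndependent.natCard_le_ringKrullDim {k A ι : Type*} [Field k]
    [CommRing A] [Algebra k A] [Algebra.FiniteType k A] [Finite ι] {x : ι → A}
    (hx : AlgebraicIndependent k x) : (Nat.card ι : WithBot ℕ∞) ≤ ringKrullDim A := by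
  let S : Submonoid A := (nonZeroDivisors (MvPolynomial ι k)).map (MvPolynomial.aeval (R := k) x)
  have hS : Disjoint ((⊥ : Ideal A) : Set A) S := by
    rw [Set.disjoint_left]
    rintro _ h0 ⟨p, hp, rfl⟩
    have : p = 0 := hx (by simpa using h0)
    exact nonZeroDivisors.ne_zero hp this
  obtain ⟨P, hP, -, hdisj⟩ := Ideal.exists_le_prime_disjoint ⊥ S hS
  refine le_trans ?_ (ringKrullDim_le_of_surjective _ (Ideal.Quotient.mk_surjective (I := P)))
  refine AlgebraicIndependent.natCard_le_ringKrullDim_of_isDomain (k := k)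
    (x := fun i => Ideal.Quotient.mkₐ k P (x i)) ?_
  refine (injective_iff_map_eq_zero _).2 fun p hp => ?_
  have h1 : MvPolynomial.aeval (fun i => Ideal.Quotient.mkₐ k P (x i)) p
      = Ideal.Quotient.mkₐ k P (MvPolynomial.aeval x p) := by
    rw [← AlgHom.comp_apply, MvPolynomial.comp_aeval]
  rw [h1, Ideal.Quotient.mkₐ_eq_mk, Ideal.Quotient.eq_zero_iff_mem] at hp
  by_contra h0
  exact Set.disjoint_left.1 hdisj hp ⟨p, mem_nonZeroDivisors_of_ne_zero h0, rfl⟩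

/-- A complex polynomial that vanishes on a neighbourhood of a point is zero. -/
theorem MvPolynomial.eq_zero_of_eventually_eval_eq_zero {ι : Type*} [Fintype ι]
    (p : MvPolynomial ι ℂ) (z : ι → ℂ) (h : ∀ᶠ w in nhds z, MvPolynomial.eval w p = 0) :
    p = 0 := by
  obtain ⟨ε, hε, hb⟩ := Metric.eventually_nhds_iff_ball.1 h
  refine MvPolynomial.funext_set (fun i => Metric.ball (z i) ε) (fun i => ?_) fun w hw => ?_
  · exact infinite_of_mem_nhds (z i) (Metric.ball_mem_nhds _ hε)
  · rw [map_zero]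
    refine hb w ?_
    rw [Metric.mem_ball, dist_pi_lt_iff hε]
    exact fun i => hw i trivial

/-! ### Coordinate rings and dimensions of subsets of a vector space -/

namespace AffineVar

variable {W W' : Type*} [AddCommGroup W] [Module ℂ W] [AddCommGroup W'] [Module ℂ W']

/-- The restriction of a linear form, as an element of the coordinate ring. -/
def coord (X : Set W) (l : Module.Dual ℂ W) : coordRing X :=
  ⟨fun x => l x, Algebra.subset_adjoin ⟨l, rfl⟩⟩

theorem mem_coordRing_dual (X : Set W) (l : Module.Dual ℂ W) :
    (fun x : X => l x) ∈ coordRing X := (coord X l).2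

theorem coordRing_eq_adjoin_basis {κ : Type*} [Finite κ] (b : Module.Basis κ ℂ W) (X : Set W) :
    coordRing X = Algebra.adjoin ℂ (Set.range fun i (x : X) => b.coord i x) := by
  have := Fintype.ofFinite κ
  refine le_antisymm (Algebra.adjoin_le ?_) (Algebra.adjoin_mono ?_)
  · rintro _ ⟨l, rfl⟩
    have : (fun x : X => l x) = ∑ i, l (b i) • fun x : X => b.coord i x := by
      funext x
      conv_lhs => rw [← b.sum_repr (x : W)]
      rw [map_sum, Finset.sum_apply]
      refine Finset.sum_congr rfl fun i _ => ?_
      rw [map_smul, smul_eq_mul, mul_comm]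
      rfl
    dsimp only
    rw [this]
    exact Subalgebra.sum_mem _ fun i _ =>
      Subalgebra.smul_mem _ (Algebra.subset_adjoin (Set.mem_range_self i)) _
  · rintro _ ⟨i, rfl⟩
    exact ⟨b.coord i, rfl⟩

instance finiteType_coordRing [FiniteDimensional ℂ W] (X : Set W) :
    Algebra.FiniteType ℂ (coordRing X) := by
  rw [coordRing_eq_adjoin_basis (Module.finBasis ℂ W) X]
  exact Subalgebra.fg_iff_finiteType _ |>.1
    (Subalgebra.fg_def.2 ⟨_, Set.finite_range _, rfl⟩)

theorem coe_aeval_coord {ι : Type*} (X : Set W) (l : ι → Module.Dual ℂ W)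
    (p : MvPolynomial ι ℂ) (x : X) :
    (MvPolynomial.aeval (fun i => coord X (l i)) p : coordRing X).1 x
      = MvPolynomial.eval (fun i => l i x) p := by
  induction p using MvPolynomial.induction_on with
  | C c => simp
  | add p q hp hq => simp_all
  | mul_X p i hp => simp_all [coord]

/-- If some linear forms map a subset of a vector space onto a neighbourhood of a point, then
the number of these forms is a lower bound for the dimension of the subset. -/
theorem natCard_le_dim [FiniteDimensional ℂ W] {ι : Type*} [Fintype ι] (X : Set W)
    (l : ι → Module.Dual ℂ W) (z : ι → ℂ) (h : ∀ᶠ w in nhds z, ∃ x ∈ X, ∀ i, l i x = w i) :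
    (Nat.card ι : WithBot ℕ∞) ≤ dim X := by
  refine AlgebraicIndependent.natCard_le_ringKrullDim (k := ℂ) (x := fun i => coord X (l i)) ?_
  refine (injective_iff_map_eq_zero _).2 fun p hp => ?_
  refine MvPolynomial.eq_zero_of_eventually_eval_eq_zero p z (h.mono ?_)
  rintro w ⟨x, hx, hxw⟩
  have h1 := coe_aeval_coord X l p ⟨x, hx⟩
  rw [hp] at h1
  rw [← funext hxw]
  exact h1.symm

/-- The dimension of a subset that lies on a hypersurface. -/
theorem dim_add_one_le {ι : Type*} [Finite ι] (b : Module.Basis ι ℂ W) (X : Set W)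
    (p : MvPolynomial ι ℂ) (hp : p ≠ 0)
    (h : ∀ x ∈ X, MvPolynomial.eval (fun i => b.coord i x) p = 0) :
    dim X + 1 ≤ Nat.card ι := by
  let f : MvPolynomial ι ℂ →ₐ[ℂ] coordRing X := MvPolynomial.aeval fun i => coord X (b.coord i)
  have hf : Function.Surjective f := by
    have h1 : Algebra.adjoin ℂ (Set.range fun i => coord X (b.coord i)) = ⊤ := by
      have h2 := coordRing_eq_adjoin_basis b X
      apply Subalgebra.map_injective (f := (coordRing X).val) Subtype.val_injective
      rw [AlgHom.map_adjoin, ← Set.range_comp, Algebra.map_top, Subalgebra.range_val]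
      exact h2.symm
    rw [← AlgHom.range_eq_top, ← h1, Algebra.adjoin_range_eq_range_aeval]
  -- The coordinate ring is a quotient of the polynomial ring by an ideal containing the
  -- nonzerodivisor `p`, so the dimension drops by at least one.
  have h1 := ringKrullDim_succ_le_of_surjective f.toRingHom hf
    (mem_nonZeroDivisors_of_ne_zero hp) (by
      apply Subtype.ext
      funext x
      exact (coe_aeval_coord X b.coord p x).trans (h x x.2))
  rw [MvPolynomial.ringKrullDim_of_isNoetherianRing, ringKrullDim_eq_zero_of_field, zero_add] at h1
  exact h1

/-- A function on a point that is not zero is a nonzero constant, so the coordinate ring is a field.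
-/
theorem dim_singleton (w : W) : dim ({w} : Set W) = 0 := by
  refine ringKrullDim_eq_zero_of_isField ⟨⟨0, 1, zero_ne_one⟩, mul_comm, fun {f} hf => ?_⟩
  have h0 : f.1 ⟨w, rfl⟩ ≠ 0 := fun h => hf (Subtype.ext (funext fun x => by
    rw [Subsingleton.elim x ⟨w, rfl⟩, h]; rfl))
  refine ⟨algebraMap ℂ _ (f.1 ⟨w, rfl⟩)⁻¹, Subtype.ext (funext fun x => ?_)⟩
  rw [Subsingleton.elim x ⟨w, rfl⟩]
  exact mul_inv_cancel₀ h0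

theorem IsIso.dim_eq {X : Set W} {Y : Set W'} {f : X ≃ Y} (hf : IsIso f) : dim X = dim Y := by
  let F : (Y → ℂ) →ₐ[ℂ] (X → ℂ) := AlgHom.pi fun x => Pi.evalAlgHom ℂ _ (f x)
  let G : (X → ℂ) →ₐ[ℂ] (Y → ℂ) := AlgHom.pi fun y => Pi.evalAlgHom ℂ _ (f.symm y)
  refine ringKrullDim_eq_of_ringEquiv (RingEquiv.ofRingHom
    ((G.comp (coordRing X).val).codRestrict (coordRing Y) fun h => hf.2 h.1 h.2).toRingHom
    ((F.comp (coordRing Y).val).codRestrict (coordRing X) fun h => hf.1 h.1 h.2).toRingHom ?_ ?_)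
  · ext h y
    exact congrArg h.1 (f.apply_symm_apply y)
  · ext h x
    exact congrArg h.1 (f.symm_apply_apply x)

theorem isRegular_of_dual {X : Set W} {Y : Set W'} (f : X → Y)
    (h : ∀ l : Module.Dual ℂ W', (fun x => l (f x)) ∈ coordRing X) : IsRegular f := by
  let F : (Y → ℂ) →ₐ[ℂ] (X → ℂ) := AlgHom.pi fun x => Pi.evalAlgHom ℂ _ (f x)
  have : coordRing Y ≤ (coordRing X).comap F := by
    refine Algebra.adjoin_le ?_
    rintro _ ⟨l, rfl⟩
    exact h l
  exact fun g hg => this hg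

end AffineVar

/-! ### Octonion identities -/

namespace ComplexOctonion
theorem sum_seven (f : ZMod 7 → ℂ) :
    ∑ k, f k = f 0 + f 1 + f 2 + f 3 + f 4 + f 5 + f 6 := Fin.sum_univ_seven f

theorem forall_seven {p : ZMod 7 → Prop} :
    (∀ k, p k) ↔ p 0 ∧ p 1 ∧ p 2 ∧ p 3 ∧ p 4 ∧ p 5 ∧ p 6 := by
  refine ⟨fun h => ⟨h _, h _, h _, h _, h _, h _, h _⟩, fun ⟨h0, h1, h2, h3, h4, h5, h6⟩ k => ?_⟩
  fin_cases k
  exacts [h0, h1, h2, h3, h4, h5, h6]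

/-- With all eight coordinates explicit, the alternative, flexible and Moufang laws and the
multiplicativity of the norm become polynomial identities that `ring` decides. -/
theorem ext_iff_seven {x y : ComplexOctonion} : x = y ↔ x.re = y.re ∧ x.im 0 = y.im 0 ∧
    x.im 1 = y.im 1 ∧ x.im 2 = y.im 2 ∧ x.im 3 = y.im 3 ∧ x.im 4 = y.im 4 ∧ x.im 5 = y.im 5 ∧
    x.im 6 = y.im 6 := by
  refine ⟨fun h => by simp [h], fun ⟨h, h'⟩ => ext h (forall_seven.2 h')⟩

theorem im_mul_zero (x y : ComplexOctonion) : (x * y).im 0 = x.re * y.im 0 + x.im 0 * y.re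
      + (x.im 1 * y.im 3 - x.im 3 * y.im 1)
      + (x.im 2 * y.im 6 - x.im 6 * y.im 2)
      + (x.im 4 * y.im 5 - x.im 5 * y.im 4) := rfl
theorem im_mul_one (x y : ComplexOctonion) : (x * y).im 1 = x.re * y.im 1 + x.im 1 * y.re
      + (x.im 2 * y.im 4 - x.im 4 * y.im 2)
      + (x.im 3 * y.im 0 - x.im 0 * y.im 3)
      + (x.im 5 * y.im 6 - x.im 6 * y.im 5) := rfl
theorem im_mul_two (x y : ComplexOctonion) : (x * y).im 2 = x.re * y.im 2 + x.im 2 * y.re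
      + (x.im 3 * y.im 5 - x.im 5 * y.im 3)
      + (x.im 4 * y.im 1 - x.im 1 * y.im 4)
      + (x.im 6 * y.im 0 - x.im 0 * y.im 6) := rfl
theorem im_mul_three (x y : ComplexOctonion) : (x * y).im 3 = x.re * y.im 3 + x.im 3 * y.re
      + (x.im 4 * y.im 6 - x.im 6 * y.im 4)
      + (x.im 5 * y.im 2 - x.im 2 * y.im 5)
      + (x.im 0 * y.im 1 - x.im 1 * y.im 0) := rfl
theorem im_mul_four (x y : ComplexOctonion) : (x * y).im 4 = x.re * y.im 4 + x.im 4 * y.re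
      + (x.im 5 * y.im 0 - x.im 0 * y.im 5)
      + (x.im 6 * y.im 3 - x.im 3 * y.im 6)
      + (x.im 1 * y.im 2 - x.im 2 * y.im 1) := rfl
theorem im_mul_five (x y : ComplexOctonion) : (x * y).im 5 = x.re * y.im 5 + x.im 5 * y.re
      + (x.im 6 * y.im 1 - x.im 1 * y.im 6)
      + (x.im 0 * y.im 4 - x.im 4 * y.im 0)
      + (x.im 2 * y.im 3 - x.im 3 * y.im 2) := rfl
theorem im_mul_six (x y : ComplexOctonion) : (x * y).im 6 = x.re * y.im 6 + x.im 6 * y.re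
      + (x.im 0 * y.im 2 - x.im 2 * y.im 0)
      + (x.im 1 * y.im 5 - x.im 5 * y.im 1)
      + (x.im 3 * y.im 4 - x.im 4 * y.im 3) := rfl

theorem re_mul_seven (x y : ComplexOctonion) : (x * y).re = x.re * y.re -
    (x.im 0 * y.im 0 + x.im 1 * y.im 1 + x.im 2 * y.im 2 + x.im 3 * y.im 3 + x.im 4 * y.im 4
      + x.im 5 * y.im 5 + x.im 6 * y.im 6) := by rw [re_mul, sum_seven]

theorem mul_mul_self_left (x y : ComplexOctonion) : x * (x * y) = (x * x) * y := by
  rw [ext_iff_seven]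
  simp only [re_mul_seven, im_mul_zero, im_mul_one, im_mul_two, im_mul_three, im_mul_four,
    im_mul_five, im_mul_six]
  refine ⟨?_, ?_, ?_, ?_, ?_, ?_, ?_, ?_⟩ <;> ring

theorem mul_self_mul_right (x y : ComplexOctonion) : (y * x) * x = y * (x * x) := by
  rw [ext_iff_seven]
  simp only [re_mul_seven, im_mul_zero, im_mul_one, im_mul_two, im_mul_three, im_mul_four,
    im_mul_five, im_mul_six]
  refine ⟨?_, ?_, ?_, ?_, ?_, ?_, ?_, ?_⟩ <;> ring

theorem mul_mul_flexible (x y : ComplexOctonion) : (x * y) * x = x * (y * x) := by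
  rw [ext_iff_seven]
  simp only [re_mul_seven, im_mul_zero, im_mul_one, im_mul_two, im_mul_three, im_mul_four,
    im_mul_five, im_mul_six]
  refine ⟨?_, ?_, ?_, ?_, ?_, ?_, ?_, ?_⟩ <;> ring

theorem middle_moufang (a x y : ComplexOctonion) :
    (a * x) * (y * a) = (a * (x * y)) * a := by
  rw [ext_iff_seven]
  simp only [re_mul_seven, im_mul_zero, im_mul_one, im_mul_two, im_mul_three, im_mul_four,
    im_mul_five, im_mul_six]
  refine ⟨?_, ?_, ?_, ?_, ?_, ?_, ?_, ?_⟩ <;> ring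

theorem right_moufang (a x y : ComplexOctonion) :
    ((x * a) * y) * a = x * ((a * y) * a) := by
  rw [ext_iff_seven]
  simp only [re_mul_seven, im_mul_zero, im_mul_one, im_mul_two, im_mul_three, im_mul_four,
    im_mul_five, im_mul_six]
  refine ⟨?_, ?_, ?_, ?_, ?_, ?_, ?_, ?_⟩ <;> ring

theorem re_sub (x y : ComplexOctonion) : (x - y).re = x.re - y.re := rfl
theorem im_sub (x y : ComplexOctonion) : (x - y).im = x.im - y.im := rfl
theorem re_neg (x : ComplexOctonion) : (-x).re = -x.re := rfl
theorem im_neg (x : ComplexOctonion) : (-x).im = -x.im := rfl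

theorem form_eq (x y : ComplexOctonion) : form x y = x.re * y.re +
    (x.im 0 * y.im 0 + x.im 1 * y.im 1 + x.im 2 * y.im 2 + x.im 3 * y.im 3 + x.im 4 * y.im 4
      + x.im 5 * y.im 5 + x.im 6 * y.im 6) := by
  change (x * conj y).re = _
  rw [re_mul_seven]
  simp only [conj, re_mk, im_mk, Pi.neg_apply]
  ring

theorem n_eq (x : ComplexOctonion) : n x = form x x := rfl

theorem form_comm (x y : ComplexOctonion) : form x y = form y x := by
  simp only [form_eq]; ring

theorem form_add_left (x y z : ComplexOctonion) : form (x + y) z = form x z + form y z := by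
  simp only [form_eq, re_add, im_add, Pi.add_apply]; ring

theorem form_smul_left (c : ℂ) (x y : ComplexOctonion) : form (c • x) y = c * form x y := by
  simp only [form_eq, re_smul, im_smul, Pi.smul_apply, smul_eq_mul]; ring

theorem form_add_right (x y z : ComplexOctonion) : form x (y + z) = form x y + form x z := by
  simp only [form_comm x, form_add_left]

theorem form_smul_right (c : ℂ) (x y : ComplexOctonion) : form x (c • y) = c * form x y := by
  simp only [form_comm x, form_smul_left]

/-- The linear form `⟨x, ·⟩`. -/
noncomputable def formLeft (x : ComplexOctonion) : Module.Dual ℂ ComplexOctonion where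
  toFun := form x
  map_add' := form_add_right x
  map_smul' := fun c => form_smul_right c x

theorem n_add (x y : ComplexOctonion) : n (x + y) = n x + 2 * form x y + n y := by
  simp only [n_eq, form_add_left, form_add_right, form_comm y x]; ring

theorem n_smul (c : ℂ) (x : ComplexOctonion) : n (c • x) = c ^ 2 * n x := by
  simp only [n_eq, form_smul_left, form_smul_right]; ring

theorem n_mul (x y : ComplexOctonion) : n (x * y) = n x * n y := by
  simp only [n_eq, form_eq, re_mul_seven, im_mul_zero, im_mul_one, im_mul_two, im_mul_three,
    im_mul_four, im_mul_five, im_mul_six]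
  ring

theorem form_one_left (x : ComplexOctonion) : form 1 x = x.re := by
  simp [form_eq]

/-- This quadratic equation characterizes trace and norm of a nonscalar element in terms of the
product alone, which is why automorphisms preserve both. -/
theorem mul_self_eq (x : ComplexOctonion) : x * x = (2 * x.re) • x - n x • 1 := by
  rw [ext_iff_seven]
  simp only [re_mul_seven, im_mul_zero, im_mul_one, im_mul_two, im_mul_three, im_mul_four,
    im_mul_five, im_mul_six, n_eq, form_eq, re_sub, im_sub, re_smul, im_smul, re_one, im_one,
    Pi.sub_apply, Pi.smul_apply, smul_eq_mul, Pi.zero_apply]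
  refine ⟨?_, ?_, ?_, ?_, ?_, ?_, ?_, ?_⟩ <;> ring

theorem mem_V {x : ComplexOctonion} : x ∈ V ↔ x.re = 0 := Iff.rfl

theorem mul_self_of_mem_V {x : ComplexOctonion} (hx : x.re = 0) : x * x = (-n x) • 1 := by
  rw [mul_self_eq, hx, mul_zero, zero_smul, zero_sub, neg_smul]

/-! ### Automorphisms -/

theorem map_mul_G₂ (g : G₂) (x y : ComplexOctonion) : g.1 (x * y) = g.1 x * g.1 y := g.2 x y

theorem map_one_G₂ (g : G₂) : g.1 1 = 1 := by
  have h := map_mul_G₂ g 1 (g.1.symm 1)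
  rwa [one_mul, g.1.apply_symm_apply, mul_one, eq_comm] at h

theorem re_n_map_G₂ (g : G₂) (x : ComplexOctonion) : (g.1 x).re = x.re ∧ n (g.1 x) = n x := by
  have h1 := congrArg g.1 (mul_self_eq x)
  rw [map_mul_G₂, mul_self_eq, map_sub, map_smul, map_smul, map_one_G₂] at h1
  -- The difference between the image of the quadratic equation of `x` and the quadratic equation of
  -- `g x`. If the traces differed, `g x` and hence `x` would be scalar, and then the traces agree
  -- after all.
  have h2 : (2 * ((g.1 x).re - x.re)) • g.1 x = (n (g.1 x) - n x) • (1 : ComplexOctonion) := by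
    rw [← sub_eq_zero] at h1 ⊢
    rw [← h1]
    module
  by_cases h : (g.1 x).re = x.re
  · refine ⟨h, ?_⟩
    rw [h, sub_self, mul_zero, zero_smul] at h2
    have := congrArg re h2
    rw [re_zero, re_smul, re_one, mul_one] at this
    exact (sub_eq_zero.1 this.symm)
  · exfalso
    have hc : 2 * ((g.1 x).re - x.re) ≠ 0 := mul_ne_zero two_ne_zero (sub_ne_zero.2 h)
    have h3 : g.1 x = ((2 * ((g.1 x).re - x.re))⁻¹ * (n (g.1 x) - n x)) • 1 := by
      rw [mul_smul, ← h2, smul_smul, inv_mul_cancel₀ hc, one_smul]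
    generalize (2 * ((g.1 x).re - x.re))⁻¹ * (n (g.1 x) - n x) = c at h3
    have h4 : x = c • 1 := g.1.injective (by rw [map_smul, map_one_G₂, ← h3])
    rw [h4, map_smul, map_one_G₂] at h
    exact h rfl

theorem re_map_G₂ (g : G₂) (x : ComplexOctonion) : (g.1 x).re = x.re := (re_n_map_G₂ g x).1

theorem n_map_G₂ (g : G₂) (x : ComplexOctonion) : n (g.1 x) = n x := (re_n_map_G₂ g x).2

theorem form_map_G₂ (g : G₂) (x y : ComplexOctonion) : form (g.1 x) (g.1 y) = form x y := by
  have h := n_map_G₂ g (x + y)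
  rw [map_add, n_add, n_add, n_map_G₂, n_map_G₂] at h
  linear_combination h / 2

/-! ### Conjugation by roots of unity of order six -/

/-- The hypothesis says a(1 - a) = 1. The alternative and flexible laws allow the cancellation
without associativity. -/
theorem mul_compl_conj {a : ComplexOctonion} (ha : a * a = a - 1) (q : ComplexOctonion) :
    ((1 - a) * ((a * q) * (1 - a))) * a = q := by
  have hl : (1 - a) * (a * q) = q := by
    rw [sub_mul, one_mul, mul_mul_self_left, ha, sub_mul, one_mul, sub_sub_cancel]
  have hr : (q * (1 - a)) * a = q := by
    rw [mul_sub, mul_one, sub_mul, mul_self_mul_right, ha, mul_sub, mul_one, sub_sub_cancel]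
  have h : (1 - a) * ((a * q) * (1 - a)) = q * (1 - a) := by
    rw [← mul_mul_flexible, hl]
  rw [h, hr]

theorem compl_mul_self {a : ComplexOctonion} (ha : a * a = a - 1) :
    (1 - a) * (1 - a) = (1 - a) - 1 := by
  rw [mul_sub, mul_one, sub_mul, one_mul, ha]; abel

/-- Here 1 - a = -a². Writing the right factor 1 - a as two successive right multiplications by `a`
lets the middle Moufang law take out an outer pair of factors `a`, and the right Moufang law then
cancels the inner `a` against 1 - a. -/
theorem conj_mul_conj {a : ComplexOctonion} (ha : a * a = a - 1) (x y : ComplexOctonion) :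
    ((a * x) * (1 - a)) * ((a * y) * (1 - a)) = (a * (x * y)) * (1 - a) := by
  have key : ∀ z, z * (1 - a) = -((z * a) * a) := fun z => by
    rw [mul_self_mul_right, ha, mul_sub, mul_sub, mul_one]; abel
  have hr : (x * (1 - a)) * a = x := by
    rw [mul_sub, mul_one, sub_mul, mul_self_mul_right, ha, mul_sub, mul_one, sub_sub_cancel]
  have hx : (a * x) * (1 - a) = a * (x * (1 - a)) := by
    rw [mul_sub, mul_sub, mul_one, mul_one, mul_sub, mul_mul_flexible]
  rw [key (a * y), hx, mul_neg, middle_moufang, ← right_moufang, hr, ← mul_mul_flexible, ← key]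

/-- Squaring replaces `a` by a² = -(1 - a) and 1 - a by (1 - a)² = -a. The signs cancel, so T_a² is
the inverse of T_a and T_a³ = 1. -/
theorem conj_conj {a : ComplexOctonion} (ha : a * a = a - 1) (q : ComplexOctonion) :
    (a * ((a * q) * (1 - a))) * (1 - a) = ((1 - a) * q) * a := by
  have h1 : a * ((a * q) * (1 - a)) = ((a * a) * q) * (1 - a) := by
    rw [mul_sub, mul_sub, mul_one, mul_sub, ← mul_mul_flexible, mul_one, mul_mul_self_left]
  rw [h1, mul_self_mul_right, compl_mul_self ha, ha, sub_sub_cancel_left, mul_neg,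
    ← neg_mul, ← neg_mul, neg_sub]

/-- The automorphism `T_a` for `a² = a - 1`. -/
noncomputable def conjAut (a : ComplexOctonion) (ha : a * a = a - 1) : G₂ :=
  ⟨{ toFun := fun q => (a * q) * (1 - a)
     map_add' := fun x y => by rw [mul_add, add_mul]
     map_smul' := fun c x => by rw [mul_smul_comm, smul_mul_assoc]; rfl
     invFun := fun q => ((1 - a) * q) * a
     left_inv := fun q => mul_compl_conj ha q
     right_inv := fun q => by
       have := mul_compl_conj (compl_mul_self ha) q
       rwa [sub_sub_cancel] at this }, fun x y => (conj_mul_conj ha x y).symm⟩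

theorem conjAut_apply (a : ComplexOctonion) (ha : a * a = a - 1) (q : ComplexOctonion) :
    (conjAut a ha).1 q = (a * q) * (1 - a) := rfl

theorem conjAut_conjAut_conjAut (a : ComplexOctonion) (ha : a * a = a - 1) (q : ComplexOctonion) :
    (conjAut a ha).1 ((conjAut a ha).1 ((conjAut a ha).1 q)) = q := by
  simp only [conjAut_apply]
  rw [conj_conj ha]
  exact mul_compl_conj ha q

theorem a_mul_a {v : ComplexOctonion} (h0 : v.re = 0) (h3 : n v = 3) : a v * a v = a v - 1 := by
  rw [mul_self_eq]
  have h1 : (a v).re = 1 / 2 := by simp [a, h0]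
  have h2 : n (a v) = 1 := by
    rw [a, n_smul, n_add, form_one_left, h0, h3, n_eq, form_one_left, re_one]; norm_num
  rw [h1, h2, one_smul]
  norm_num

theorem inv_a {v : ComplexOctonion} (h0 : v.re = 0) (h3 : n v = 3) : (a v)⁻¹ = 1 - a v := by
  have h2 : n (a v) = 1 := by
    rw [a, n_smul, n_add, form_one_left, h0, h3, n_eq, form_one_left, re_one]; norm_num
  rw [inv_def, h2, inv_one, one_smul]
  ext k
  · simp [conj, a, re_sub, h0]; norm_num
  · simp [conj, a, im_sub]

/-- The map `v ↦ T_{a(v)}`. -/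
noncomputable def rot (v : quadric) : G₂ := conjAut (a (v : V)) (a_mul_a v.1.2 v.2)

theorem rot_apply_eq_T (v : quadric) (q : ComplexOctonion) : (rot v).1 q = T (a (v : V)) q := by
  rw [T, inv_a v.1.2 v.2]; rfl

/-- Because a(v) has norm 1 there is no denominator in `v`: the formula is polynomial and any
automorphism can be pushed through it. -/
theorem rot_apply (v : quadric) (q : ComplexOctonion) :
    (rot v).1 q = (1 / 4 : ℂ) • ((q + v.1 * q) - (q + v.1 * q) * v.1) := by
  have h : (1 : ComplexOctonion) - a v.1 = (1 / 2 : ℂ) • (1 - v.1.1) := by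
    rw [a, smul_add, smul_sub, sub_add_eq_sub_sub]
    congr 1
    rw [sub_eq_iff_eq_add, ← add_smul]; norm_num
  change (a v.1 * q) * (1 - a v.1) = _
  rw [h, a, smul_mul_assoc, smul_mul_assoc, mul_smul_comm, smul_smul, add_mul, one_mul, mul_sub,
    mul_one]
  norm_num

/-- The action of `G₂` on the quadric. -/
noncomputable def actQuadric (g : G₂) (v : quadric) : quadric :=
  ⟨⟨g.1 v.1, (re_map_G₂ g _).trans v.1.2⟩, (n_map_G₂ g _).trans v.2⟩

theorem coe_actQuadric (g : G₂) (v : quadric) :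
    ((actQuadric g v : V) : ComplexOctonion) = g.1 (v : V) := rfl

theorem rot_actQuadric (g : G₂) (v : quadric) : rot (actQuadric g v) = g * rot v * g⁻¹ := by
  rw [eq_mul_inv_iff_mul_eq]
  refine Subtype.ext (LinearEquiv.ext fun q => ?_)
  change (rot (actQuadric g v)).1 (g.1 q) = g.1 ((rot v).1 q)
  rw [rot_apply, rot_apply, coe_actQuadric]
  simp only [map_smul, map_sub, map_add, map_mul_G₂]

/-- The endomorphism is annihilated by X³ - 1, which is separable over ℂ. -/
theorem isSemisimple_toEnd_rot (v : quadric) : (toEnd (rot v)).IsSemisimple := by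
  have h : toEnd (rot v) ^ 3 = 1 := by
    refine LinearMap.ext fun q => ?_
    exact conjAut_conjAut_conjAut _ (a_mul_a v.1.2 v.2) q
  refine Module.End.isSemisimple_of_squarefree_aeval_eq_zero
    (p := Polynomial.X ^ 3 - Polynomial.C 1) ?_ ?_
  · exact (Polynomial.separable_X_pow_sub_C (n := 3) (1 : ℂ) (by norm_num) one_ne_zero).squarefree
  · simp [h]

theorem e_im (i j : ZMod 7) : (e i).im j = if j = i then 1 else 0 := by
  simp [e, Pi.single_apply]

theorem e_re (i : ZMod 7) : (e i).re = 0 := rfl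

/-- The maps q ↦ q and q ↦ (vq)v are symmetric for the form, so a difference of transposed entries
only sees (vq - qv)/4. Since eₖ eₖ₊₁ = eₖ₊₃, the two entries chosen contribute half of the k-th
coordinate each. -/
theorem im_eq_rot (v : quadric) (k : ZMod 7) : (v : V).1.im k =
    ((rot v).1 (e (k + 1))).im (k + 3) - ((rot v).1 (e (k + 3))).im (k + 1) := by
  have h0 : v.1.1.re = 0 := v.1.2
  simp only [rot_apply]
  generalize v.1.1 = w at *
  have key : ∀ i j : ZMod 7, ((1 / 4 : ℂ) • ((e i + w * e i) - (e i + w * e i) * w)).im j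
      = 1 / 4 * ((e i).im j + (w * e i).im j - (e i * w).im j - (w * e i * w).im j) := fun i j => by
    rw [add_mul, im_smul, im_sub, im_add, im_add]
    simp only [Pi.smul_apply, Pi.sub_apply, Pi.add_apply, smul_eq_mul]
    ring
  rw [key, key]
  revert k
  rw [forall_seven]
  refine ⟨?_, ?_, ?_, ?_, ?_, ?_, ?_⟩
  · change w.im 0 = 1 / 4 * ((e 1).im 3 + (w * e 1).im 3 - (e 1 * w).im 3 - (w * e 1 * w).im 3)
      - 1 / 4 * ((e 3).im 1 + (w * e 3).im 1 - (e 3 * w).im 1 - (w * e 3 * w).im 1)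
    simp +decide only [re_mul_seven, im_mul_zero, im_mul_one, im_mul_two, im_mul_three, im_mul_four,
      im_mul_five, im_mul_six, e_im, e_re, h0, if_true, if_false]
    ring
  · change w.im 1 = 1 / 4 * ((e 2).im 4 + (w * e 2).im 4 - (e 2 * w).im 4 - (w * e 2 * w).im 4)
      - 1 / 4 * ((e 4).im 2 + (w * e 4).im 2 - (e 4 * w).im 2 - (w * e 4 * w).im 2)
    simp +decide only [re_mul_seven, im_mul_zero, im_mul_one, im_mul_two, im_mul_three, im_mul_four,
      im_mul_five, im_mul_six, e_im, e_re, h0, if_true, if_false]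
    ring
  · change w.im 2 = 1 / 4 * ((e 3).im 5 + (w * e 3).im 5 - (e 3 * w).im 5 - (w * e 3 * w).im 5)
      - 1 / 4 * ((e 5).im 3 + (w * e 5).im 3 - (e 5 * w).im 3 - (w * e 5 * w).im 3)
    simp +decide only [re_mul_seven, im_mul_zero, im_mul_one, im_mul_two, im_mul_three, im_mul_four,
      im_mul_five, im_mul_six, e_im, e_re, h0, if_true, if_false]
    ring
  · change w.im 3 = 1 / 4 * ((e 4).im 6 + (w * e 4).im 6 - (e 4 * w).im 6 - (w * e 4 * w).im 6)
      - 1 / 4 * ((e 6).im 4 + (w * e 6).im 4 - (e 6 * w).im 4 - (w * e 6 * w).im 4)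
    simp +decide only [re_mul_seven, im_mul_zero, im_mul_one, im_mul_two, im_mul_three, im_mul_four,
      im_mul_five, im_mul_six, e_im, e_re, h0, if_true, if_false]
    ring
  · change w.im 4 = 1 / 4 * ((e 5).im 0 + (w * e 5).im 0 - (e 5 * w).im 0 - (w * e 5 * w).im 0)
      - 1 / 4 * ((e 0).im 5 + (w * e 0).im 5 - (e 0 * w).im 5 - (w * e 0 * w).im 5)
    simp +decide only [re_mul_seven, im_mul_zero, im_mul_one, im_mul_two, im_mul_three, im_mul_four,
      im_mul_five, im_mul_six, e_im, e_re, h0, if_true, if_false]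
    ring
  · change w.im 5 = 1 / 4 * ((e 6).im 1 + (w * e 6).im 1 - (e 6 * w).im 1 - (w * e 6 * w).im 1)
      - 1 / 4 * ((e 1).im 6 + (w * e 1).im 6 - (e 1 * w).im 6 - (w * e 1 * w).im 6)
    simp +decide only [re_mul_seven, im_mul_zero, im_mul_one, im_mul_two, im_mul_three, im_mul_four,
      im_mul_five, im_mul_six, e_im, e_re, h0, if_true, if_false]
    ring
  · change w.im 6 = 1 / 4 * ((e 0).im 2 + (w * e 0).im 2 - (e 0 * w).im 2 - (w * e 0 * w).im 2)
      - 1 / 4 * ((e 2).im 0 + (w * e 2).im 0 - (e 2 * w).im 0 - (w * e 2 * w).im 0)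
    simp +decide only [re_mul_seven, im_mul_zero, im_mul_one, im_mul_two, im_mul_three, im_mul_four,
      im_mul_five, im_mul_six, e_im, e_re, h0, if_true, if_false]
    ring
/-! ### Transitivity on the quadric -/

theorem mul_add_mul_of_re_eq_zero {v w : ComplexOctonion} (hv : v.re = 0) (hw : w.re = 0) :
    v * w + w * v = (-2 * form v w) • 1 := by
  have h := mul_self_of_mem_V (x := v + w) (by rw [re_add, hv, hw, add_zero])
  rw [mul_add, add_mul, add_mul, mul_self_of_mem_V hv, mul_self_of_mem_V hw, n_add] at h
  rw [← sub_eq_zero] at h ⊢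
  rw [← h]
  module

theorem re_mul_of_re_eq_zero {v w : ComplexOctonion} (hv : v.re = 0) :
    (v * w).re = -form v w := by
  rw [re_mul_seven, form_eq, hv]; ring

/-- Two such points are at an angle of 120°. The element u = 1 - (2/3)wv is imaginary of norm 3 and
orthogonal to both, and on its orthogonal complement T_{a(u)} is q ↦ (-q + uq)/2. As uv = v + 2w,
this sends `v` to `w`. -/
theorem exists_map_eq_of_form_eq {v w : quadric} (h : form v.1 w.1 = -3 / 2) :
    ∃ g : G₂, g.1 v.1 = w.1 := by
  obtain ⟨⟨v, hv⟩, hnv⟩ := v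
  obtain ⟨⟨w, hw⟩, hnw⟩ := w
  change form v w = -3 / 2 at h
  change n v = 3 at hnv
  change n w = 3 at hnw
  change v.re = 0 at hv
  change w.re = 0 at hw
  have hre : (w * v).re = 3 / 2 := by
    rw [re_mul_of_re_eq_zero hw, form_comm, h]; norm_num
  have hu0 : ((1 : ComplexOctonion) + (-2 / 3 : ℂ) • (w * v)).re = 0 := by
    rw [re_add, re_one, re_smul, hre]; norm_num
  have hu3 : n ((1 : ComplexOctonion) + (-2 / 3 : ℂ) • (w * v)) = 3 := by
    rw [n_add, n_smul, form_smul_right, form_one_left, hre, n_mul, hnv, hnw, n_eq,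
      form_one_left, re_one]
    norm_num
  refine ⟨rot ⟨⟨_, hu0⟩, hu3⟩, ?_⟩
  rw [rot_apply]
  have hvv : v * v = (-3 : ℂ) • 1 := by rw [mul_self_of_mem_V hv, hnv]
  have hww : w * w = (-3 : ℂ) • 1 := by rw [mul_self_of_mem_V hw, hnw]
  have hvw : v * w = (3 : ℂ) • 1 - w * v := by
    rw [eq_sub_iff_add_eq, mul_add_mul_of_re_eq_zero hv hw, h]; norm_num
  have h1 : (w * v) * v = (-3 : ℂ) • w := by
    rw [mul_self_mul_right, hvv, mul_smul_comm, mul_one]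
  have h2 : w * (w * v) = (-3 : ℂ) • v := by
    rw [mul_mul_self_left, hww, smul_mul_assoc, one_mul]
  have h3 : v * (w * v) = (3 : ℂ) • v + (3 : ℂ) • w := by
    rw [← mul_mul_flexible, hvw, sub_mul, smul_mul_assoc, one_mul, h1]
    module
  simp only [add_mul, mul_add, one_mul, mul_one, smul_mul_assoc, mul_smul_comm, h1, h2, h3]
  module

theorem form_e (x : ComplexOctonion) (k : ZMod 7) : form x (e k) = x.im k := by
  revert k
  rw [forall_seven]
  refine ⟨?_, ?_, ?_, ?_, ?_, ?_, ?_⟩ <;> simp +decide [form_eq, e_im, e_re]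

/-- An intermediate point `r` at an angle of 120° from both `p` and c e₀ permits passing from `p` to
c e₀ by two rotations. -/
theorem exists_form_eq (p : quadric) (c : ℂ) (hc : c ^ 2 = 3)
    (hp : ∃ j, j ≠ 0 ∧ (p : V).1.im j ≠ 0) :
    ∃ r : quadric, form p.1 r.1 = -3 / 2 ∧ (r : V).1.im 0 * c = -3 / 2 := by
  obtain ⟨j, hj, hpj⟩ := hp
  obtain ⟨⟨p, hp⟩, hnp⟩ := p
  change p.im j ≠ 0 at hpj
  have hc0 : c ≠ 0 := by rintro rfl; norm_num at hc
  obtain ⟨a, b, ha, hb, hab, hn⟩ : ∃ a b : ZMod 7, a ≠ 0 ∧ b ≠ 0 ∧ a ≠ b ∧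
      p.im a ^ 2 + p.im b ^ 2 ≠ 0 := by
    -- If all pairwise sums of squares of the coordinates at `a`, `b`, `j` vanished, the coordinate
    -- at `j` would vanish as well.
    have hd : ∀ j : ZMod 7, j ≠ 0 → ∃ a b : ZMod 7, a ≠ 0 ∧ b ≠ 0 ∧ a ≠ b ∧ a ≠ j ∧ b ≠ j := by
      decide
    obtain ⟨a, b, ha, hb, hab, haj, hbj⟩ := hd j hj
    by_contra! h
    have h1 := h a b ha hb hab
    have h2 := h a j ha hj haj
    have h3 := h b j hb hj hbj
    refine hpj (pow_eq_zero_iff (n := 2) two_ne_zero |>.1 ?_)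
    linear_combination (h2 + h3 - h1) / 2
  -- The vector `z` is orthogonal to `p` and e₀ and is not isotropic. The vector `r₁` meets both
  -- linear conditions, so r₁ + tz does too, and the norm condition is a quadratic equation for `t`.
  let z := p.im a • e b + (-p.im b) • e a
  let r₁ := (-c / 2) • e 0 + ((-3 / 2 + c / 2 * p.im 0) / p.im j) • e j
  have hee : ∀ i k, form (e i) (e k) = if k = i then 1 else 0 := fun i k => by
    rw [form_e, e_im]
  have hz : n z = p.im a ^ 2 + p.im b ^ 2 := by
    simp only [z, n_eq, form_add_left, form_add_right, form_smul_left, form_smul_right, hee,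
      if_neg hab, if_neg hab.symm, if_true]
    ring
  have hpz : form p z = 0 := by
    simp only [z, form_add_right, form_smul_right, form_e]; ring
  have hz0 : form z (e 0) = 0 := by
    simp only [z, form_add_left, form_smul_left, hee, if_neg ha.symm, if_neg hb.symm]; ring
  have hpr : form p r₁ = -3 / 2 := by
    simp only [r₁, form_add_right, form_smul_right, form_e]
    field_simp
    ring
  have hr0 : form r₁ (e 0) = -c / 2 := by
    simp only [r₁, form_add_left, form_smul_left, hee, if_neg hj.symm, if_true]; ring
  obtain ⟨t, ht⟩ : ∃ t, n z * (t * t) + (2 * form r₁ z) * t + (n r₁ - 3) = 0 :=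
    exists_quadratic_eq_zero (by rwa [hz]) ⟨_, (Complex.cpow_nat_inv_pow _ two_ne_zero).symm.trans
      (sq _)⟩
  refine ⟨⟨⟨r₁ + t • z, ?_⟩, ?_⟩, ?_, ?_⟩
  · rw [mem_V]
    simp [r₁, z, e_re, re_neg]
  · change n (r₁ + t • z) = 3
    rw [n_add, n_smul, form_smul_right]
    linear_combination ht
  · change form p (r₁ + t • z) = _
    rw [form_add_right, form_smul_right, hpr, hpz, mul_zero, add_zero]
  · change (r₁ + t • z).im 0 * c = _
    rw [← form_e, form_add_left, form_smul_left, hr0, hz0]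
    linear_combination -hc / 2

/-- The point `c e₀` of the quadric, where `c² = 3`. -/
noncomputable def basePoint (c : ℂ) (hc : c ^ 2 = 3) : quadric :=
  ⟨⟨c • e 0, by rw [mem_V]; simp [e_re]⟩, by
    change n (c • e 0) = 3
    rw [n_smul, n_eq, form_e, e_im, if_pos rfl, mul_one, hc]⟩

theorem exists_map_eq_basePoint (p : quadric) (c : ℂ) (hc : c ^ 2 = 3) :
    ∃ g : G₂, actQuadric g p = basePoint c hc := by
  have key : ∀ p : quadric, (∃ j, j ≠ 0 ∧ (p : V).1.im j ≠ 0) →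
      ∃ g : G₂, g.1 p.1 = (basePoint c hc).1 := fun p hp => by
    obtain ⟨r, hpr, hr⟩ := exists_form_eq p c hc hp
    obtain ⟨g, hg⟩ := exists_map_eq_of_form_eq hpr
    have h1 : form r.1 (basePoint c hc).1 = -3 / 2 := by
      change form _ (c • e 0) = _
      rw [form_smul_right, form_e, mul_comm, hr]
    obtain ⟨g', hg'⟩ := exists_map_eq_of_form_eq h1
    exact ⟨g' * g, by rw [← hg', ← hg]; rfl⟩
  suffices ∃ g : G₂, g.1 p.1 = (basePoint c hc).1 by
    obtain ⟨g, hg⟩ := this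
    exact ⟨g, Subtype.ext (Subtype.ext hg)⟩
  by_cases hp : ∃ j, j ≠ 0 ∧ (p : V).1.im j ≠ 0
  · exact key p hp
  · push Not at hp
    have h0 : (p : V).1 = ((p : V).1.im 0) • e 0 := by
      ext k
      · rw [re_smul, e_re, mul_zero]; exact p.1.2
      · rw [im_smul, Pi.smul_apply, e_im, smul_eq_mul]
        by_cases hk : k = 0
        · rw [hk, if_pos rfl, mul_one]
        · rw [hp k hk, if_neg hk, mul_zero]
    have hn : (p : V).1.im 0 ^ 2 = 3 := by
      have h := p.2
      change n _ = 3 at h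
      rwa [h0, n_smul, n_eq, form_e, e_im, if_pos rfl, mul_one] at h
    generalize (p : V).1.im 0 = s at *
    -- A multiple of e₀ is first rotated to a point with nonzero e₁-coordinate, to which the
    -- previous case applies.
    let r : quadric := ⟨⟨(-s / 2) • e 0 + (3 / 2 : ℂ) • e 1, by rw [mem_V]; simp [e_re]⟩, by
      change n ((-s / 2) • e 0 + (3 / 2 : ℂ) • e 1) = 3
      rw [n_add, n_smul, n_smul, n_eq, n_eq, form_smul_left, form_smul_right, form_e, form_e,
        form_e, e_im, e_im, e_im]
      simp +decide only [if_true, if_false]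
      linear_combination hn / 4⟩
    have hr : form p.1 r.1 = -3 / 2 := by
      rw [h0]
      change form (s • e 0) ((-s / 2) • e 0 + (3 / 2 : ℂ) • e 1) = _
      rw [form_add_right, form_smul_left, form_smul_left, form_smul_right, form_smul_right,
        form_e, form_e, e_im, e_im]
      simp +decide only [if_true, if_false]
      linear_combination -hn / 2
    obtain ⟨g, hg⟩ := exists_map_eq_of_form_eq hr
    obtain ⟨g', hg'⟩ := key r ⟨1, by decide, by
      change ((-s / 2) • e 0 + (3 / 2 : ℂ) • e 1).im 1 ≠ 0
      rw [← form_e, form_add_left, form_smul_left, form_smul_left, form_e, form_e, e_im, e_im]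
      simp +decide⟩
    exact ⟨g' * g, by rw [← hg', ← hg]; rfl⟩

theorem exists_actQuadric_eq (p q : quadric) : ∃ g : G₂, actQuadric g p = q := by
  obtain ⟨c, hc⟩ : ∃ c : ℂ, c ^ 2 = 3 := ⟨_, Complex.cpow_nat_inv_pow 3 two_ne_zero⟩
  obtain ⟨g, hg⟩ := exists_map_eq_basePoint p c hc
  obtain ⟨g', hg'⟩ := exists_map_eq_basePoint q c hc
  refine ⟨g'⁻¹ * g, Subtype.ext (Subtype.ext ?_)⟩
  have h1 : g.1 p.1 = g'.1 q.1 := congrArg (fun r : quadric => r.1.1) (hg.trans hg'.symm)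
  change g'.1.symm (g.1 p.1) = q.1
  rw [h1, g'.1.symm_apply_apply]

/-! ### Zorn's vector matrices -/

/-- The space of Zorn's vector matrices. -/
abbrev Zorn : Type := ℂ × ℂ × (Fin 3 → ℂ) × (Fin 3 → ℂ)

/-- The product of vector matrices. -/
def zmul (z w : Zorn) : Zorn :=
  (z.1 * w.1 - (z.2.2.1 0 * w.2.2.2 0 + z.2.2.1 1 * w.2.2.2 1 + z.2.2.1 2 * w.2.2.2 2),
   z.2.1 * w.2.1 - (z.2.2.2 0 * w.2.2.1 0 + z.2.2.2 1 * w.2.2.1 1 + z.2.2.2 2 * w.2.2.1 2),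
   fun i => z.1 * w.2.2.1 i + w.2.1 * z.2.2.1 i
     + (z.2.2.2 (i + 1) * w.2.2.2 (i + 2) - z.2.2.2 (i + 2) * w.2.2.2 (i + 1)),
   fun i => z.2.1 * w.2.2.2 i + w.1 * z.2.2.2 i
     + (z.2.2.1 (i + 1) * w.2.2.1 (i + 2) - z.2.2.1 (i + 2) * w.2.2.1 (i + 1)))

theorem zorn_ext_iff {z w : Zorn} : z = w ↔ z.1 = w.1 ∧ z.2.1 = w.2.1 ∧
    (z.2.2.1 0 = w.2.2.1 0 ∧ z.2.2.1 1 = w.2.2.1 1 ∧ z.2.2.1 2 = w.2.2.1 2) ∧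
    (z.2.2.2 0 = w.2.2.2 0 ∧ z.2.2.2 1 = w.2.2.2 1 ∧ z.2.2.2 2 = w.2.2.2 2) := by
  rw [Prod.ext_iff, Prod.ext_iff, Prod.ext_iff, funext_iff, funext_iff, Fin.forall_fin_succ,
    Fin.forall_fin_two, Fin.forall_fin_succ, Fin.forall_fin_two]
  rfl

/-- The coordinates `![…]` of an octonion, for a vector matrix. -/
noncomputable def zornIm (z : Zorn) : Fin 7 → ℂ :=
  ![Complex.I / 2 * (z.1 - z.2.1), (z.2.2.1 0 + z.2.2.2 0) / 2, (z.2.2.1 1 + z.2.2.2 1) / 2,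
    Complex.I / 2 * (z.2.2.1 0 - z.2.2.2 0), (z.2.2.1 2 + z.2.2.2 2) / 2,
    Complex.I / 2 * (z.2.2.1 2 - z.2.2.2 2), Complex.I / 2 * (z.2.2.1 1 - z.2.2.2 1)]

/-- The identification of the vector matrices with the octonions. -/
noncomputable def zorn : Zorn ≃ₗ[ℂ] ComplexOctonion where
  toFun z := mk ((z.1 + z.2.1) / 2) (zornIm z)
  map_add' z w := by
    rw [ext_iff_seven]
    refine ⟨?_, ?_, ?_, ?_, ?_, ?_, ?_, ?_⟩
    · change (z.1 + w.1 + (z.2.1 + w.2.1)) / 2 = (z.1 + z.2.1) / 2 + (w.1 + w.2.1) / 2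
      ring
    · change Complex.I / 2 * (z.1 + w.1 - (z.2.1 + w.2.1))
        = Complex.I / 2 * (z.1 - z.2.1) + Complex.I / 2 * (w.1 - w.2.1)
      ring
    · change (z.2.2.1 0 + w.2.2.1 0 + (z.2.2.2 0 + w.2.2.2 0)) / 2
        = (z.2.2.1 0 + z.2.2.2 0) / 2 + (w.2.2.1 0 + w.2.2.2 0) / 2
      ring
    · change (z.2.2.1 1 + w.2.2.1 1 + (z.2.2.2 1 + w.2.2.2 1)) / 2
        = (z.2.2.1 1 + z.2.2.2 1) / 2 + (w.2.2.1 1 + w.2.2.2 1) / 2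
      ring
    · change Complex.I / 2 * (z.2.2.1 0 + w.2.2.1 0 - (z.2.2.2 0 + w.2.2.2 0))
        = Complex.I / 2 * (z.2.2.1 0 - z.2.2.2 0) + Complex.I / 2 * (w.2.2.1 0 - w.2.2.2 0)
      ring
    · change (z.2.2.1 2 + w.2.2.1 2 + (z.2.2.2 2 + w.2.2.2 2)) / 2
        = (z.2.2.1 2 + z.2.2.2 2) / 2 + (w.2.2.1 2 + w.2.2.2 2) / 2
      ring
    · change Complex.I / 2 * (z.2.2.1 2 + w.2.2.1 2 - (z.2.2.2 2 + w.2.2.2 2))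
        = Complex.I / 2 * (z.2.2.1 2 - z.2.2.2 2) + Complex.I / 2 * (w.2.2.1 2 - w.2.2.2 2)
      ring
    · change Complex.I / 2 * (z.2.2.1 1 + w.2.2.1 1 - (z.2.2.2 1 + w.2.2.2 1))
        = Complex.I / 2 * (z.2.2.1 1 - z.2.2.2 1) + Complex.I / 2 * (w.2.2.1 1 - w.2.2.2 1)
      ring
  map_smul' c z := by
    rw [ext_iff_seven]
    refine ⟨?_, ?_, ?_, ?_, ?_, ?_, ?_, ?_⟩
    · change (c * z.1 + c * z.2.1) / 2 = c * ((z.1 + z.2.1) / 2)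
      ring
    · change Complex.I / 2 * (c * z.1 - c * z.2.1) = c * (Complex.I / 2 * (z.1 - z.2.1))
      ring
    · change (c * z.2.2.1 0 + c * z.2.2.2 0) / 2 = c * ((z.2.2.1 0 + z.2.2.2 0) / 2)
      ring
    · change (c * z.2.2.1 1 + c * z.2.2.2 1) / 2 = c * ((z.2.2.1 1 + z.2.2.2 1) / 2)
      ring
    · change Complex.I / 2 * (c * z.2.2.1 0 - c * z.2.2.2 0)
        = c * (Complex.I / 2 * (z.2.2.1 0 - z.2.2.2 0))
      ring
    · change (c * z.2.2.1 2 + c * z.2.2.2 2) / 2 = c * ((z.2.2.1 2 + z.2.2.2 2) / 2)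
      ring
    · change Complex.I / 2 * (c * z.2.2.1 2 - c * z.2.2.2 2)
        = c * (Complex.I / 2 * (z.2.2.1 2 - z.2.2.2 2))
      ring
    · change Complex.I / 2 * (c * z.2.2.1 1 - c * z.2.2.2 1)
        = c * (Complex.I / 2 * (z.2.2.1 1 - z.2.2.2 1))
      ring
  invFun q := (q.re - Complex.I * q.im 0, q.re + Complex.I * q.im 0,
    ![q.im 1 - Complex.I * q.im 3, q.im 2 - Complex.I * q.im 6, q.im 4 - Complex.I * q.im 5],
    ![q.im 1 + Complex.I * q.im 3, q.im 2 + Complex.I * q.im 6, q.im 4 + Complex.I * q.im 5])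
  left_inv z := by
    rw [zorn_ext_iff]
    refine ⟨?_, ?_, ⟨?_, ?_, ?_⟩, ?_, ?_, ?_⟩
    · change (z.1 + z.2.1) / 2 - Complex.I * (Complex.I / 2 * (z.1 - z.2.1)) = z.1
      linear_combination (z.2.1 - z.1) / 2 * Complex.I_sq
    · change (z.1 + z.2.1) / 2 + Complex.I * (Complex.I / 2 * (z.1 - z.2.1)) = z.2.1
      linear_combination (z.1 - z.2.1) / 2 * Complex.I_sq
    · change (z.2.2.1 0 + z.2.2.2 0) / 2 - Complex.I * (Complex.I / 2 * (z.2.2.1 0 - z.2.2.2 0)) = _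
      linear_combination (z.2.2.2 0 - z.2.2.1 0) / 2 * Complex.I_sq
    · change (z.2.2.1 1 + z.2.2.2 1) / 2 - Complex.I * (Complex.I / 2 * (z.2.2.1 1 - z.2.2.2 1)) = _
      linear_combination (z.2.2.2 1 - z.2.2.1 1) / 2 * Complex.I_sq
    · change (z.2.2.1 2 + z.2.2.2 2) / 2 - Complex.I * (Complex.I / 2 * (z.2.2.1 2 - z.2.2.2 2)) = _
      linear_combination (z.2.2.2 2 - z.2.2.1 2) / 2 * Complex.I_sq
    · change (z.2.2.1 0 + z.2.2.2 0) / 2 + Complex.I * (Complex.I / 2 * (z.2.2.1 0 - z.2.2.2 0)) = _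
      linear_combination (z.2.2.1 0 - z.2.2.2 0) / 2 * Complex.I_sq
    · change (z.2.2.1 1 + z.2.2.2 1) / 2 + Complex.I * (Complex.I / 2 * (z.2.2.1 1 - z.2.2.2 1)) = _
      linear_combination (z.2.2.1 1 - z.2.2.2 1) / 2 * Complex.I_sq
    · change (z.2.2.1 2 + z.2.2.2 2) / 2 + Complex.I * (Complex.I / 2 * (z.2.2.1 2 - z.2.2.2 2)) = _
      linear_combination (z.2.2.1 2 - z.2.2.2 2) / 2 * Complex.I_sq
  right_inv q := by
    rw [ext_iff_seven]
    have h : ∀ x y : ℂ, (x - Complex.I * y + (x + Complex.I * y)) / 2 = x := fun x y => by ring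
    have h' : ∀ x y : ℂ, Complex.I / 2 * (x - Complex.I * y - (x + Complex.I * y)) = y :=
      fun x y => by linear_combination -y * Complex.I_sq
    exact ⟨h _ _, h' _ _, h _ _, h _ _, h' _ _, h _ _, h' _ _, h' _ _⟩

theorem zorn_re (z : Zorn) : (zorn z).re = (z.1 + z.2.1) / 2 := rfl
theorem zorn_im_zero (z : Zorn) : (zorn z).im 0 = Complex.I / 2 * (z.1 - z.2.1) := rfl
theorem zorn_im_one (z : Zorn) : (zorn z).im 1 = (z.2.2.1 0 + z.2.2.2 0) / 2 := rfl
theorem zorn_im_two (z : Zorn) : (zorn z).im 2 = (z.2.2.1 1 + z.2.2.2 1) / 2 := rfl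
theorem zorn_im_three (z : Zorn) : (zorn z).im 3 = Complex.I / 2 * (z.2.2.1 0 - z.2.2.2 0) := rfl
theorem zorn_im_four (z : Zorn) : (zorn z).im 4 = (z.2.2.1 2 + z.2.2.2 2) / 2 := rfl
theorem zorn_im_five (z : Zorn) : (zorn z).im 5 = Complex.I / 2 * (z.2.2.1 2 - z.2.2.2 2) := rfl
theorem zorn_im_six (z : Zorn) : (zorn z).im 6 = Complex.I / 2 * (z.2.2.1 1 - z.2.2.2 1) := rfl

theorem zmul_coord (z w : Zorn) :
    ((zmul z w).2.2.1 0 = z.1 * w.2.2.1 0 + w.2.1 * z.2.2.1 0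
      + (z.2.2.2 1 * w.2.2.2 2 - z.2.2.2 2 * w.2.2.2 1) ∧
    (zmul z w).2.2.1 1 = z.1 * w.2.2.1 1 + w.2.1 * z.2.2.1 1
      + (z.2.2.2 2 * w.2.2.2 0 - z.2.2.2 0 * w.2.2.2 2) ∧
    (zmul z w).2.2.1 2 = z.1 * w.2.2.1 2 + w.2.1 * z.2.2.1 2
      + (z.2.2.2 0 * w.2.2.2 1 - z.2.2.2 1 * w.2.2.2 0)) ∧
    (zmul z w).2.2.2 0 = z.2.1 * w.2.2.2 0 + w.1 * z.2.2.2 0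
      + (z.2.2.1 1 * w.2.2.1 2 - z.2.2.1 2 * w.2.2.1 1) ∧
    (zmul z w).2.2.2 1 = z.2.1 * w.2.2.2 1 + w.1 * z.2.2.2 1
      + (z.2.2.1 2 * w.2.2.1 0 - z.2.2.1 0 * w.2.2.1 2) ∧
    (zmul z w).2.2.2 2 = z.2.1 * w.2.2.2 2 + w.1 * z.2.2.2 2
      + (z.2.2.1 0 * w.2.2.1 1 - z.2.2.1 1 * w.2.2.1 0) :=
  ⟨⟨rfl, rfl, rfl⟩, rfl, rfl, rfl⟩

theorem zmul_fst (z w : Zorn) : (zmul z w).1 =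
    z.1 * w.1 - (z.2.2.1 0 * w.2.2.2 0 + z.2.2.1 1 * w.2.2.2 1 + z.2.2.1 2 * w.2.2.2 2) := rfl

theorem zmul_snd (z w : Zorn) : (zmul z w).2.1 =
    z.2.1 * w.2.1 - (z.2.2.2 0 * w.2.2.1 0 + z.2.2.2 1 * w.2.2.1 1 + z.2.2.2 2 * w.2.2.1 2) := rfl

theorem zorn_zmul (z w : Zorn) : zorn (zmul z w) = zorn z * zorn w := by
  obtain ⟨⟨x0, x1, x2⟩, y0, y1, y2⟩ := zmul_coord z w
  have hI := Complex.I_sq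
  rw [ext_iff_seven]
  simp only [re_mul_seven, im_mul_zero, im_mul_one, im_mul_two, im_mul_three, im_mul_four,
    im_mul_five, im_mul_six, zorn_re, zorn_im_zero, zorn_im_one, zorn_im_two, zorn_im_three,
    zorn_im_four, zorn_im_five, zorn_im_six, x0, x1, x2, y0, y1, y2, zmul_fst, zmul_snd]
  refine ⟨?_, ?_, ?_, ?_, ?_, ?_, ?_, ?_⟩ <;> ring_nf <;> rw [hI] <;> ring

/-- The automorphism of the octonions given by an automorphism of the algebra of vector matrices. -/
noncomputable def zornAut (θ : Zorn ≃ₗ[ℂ] Zorn) (h : ∀ z w, θ (zmul z w) = zmul (θ z) (θ w)) : G₂ :=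
  ⟨zorn.symm.trans (θ.trans zorn), fun x y => by
    obtain ⟨z, rfl⟩ := zorn.surjective x
    obtain ⟨w, rfl⟩ := zorn.surjective y
    simp only [LinearEquiv.trans_apply, ← zorn_zmul, zorn.symm_apply_apply, h]⟩

theorem zornAut_apply (θ : Zorn ≃ₗ[ℂ] Zorn) (h : ∀ z w, θ (zmul z w) = zmul (θ z) (θ w))
    (z : Zorn) : (zornAut θ h).1 (zorn z) = zorn (θ z) := by
  change zorn (θ (zorn.symm (zorn z))) = _
  rw [zorn.symm_apply_apply]

/-- The cofactors of a `3 × 3` matrix. -/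
def cofactor (P : Fin 3 → Fin 3 → ℂ) (i j : Fin 3) : ℂ :=
  P (i + 1) (j + 1) * P (i + 2) (j + 2) - P (i + 1) (j + 2) * P (i + 2) (j + 1)

/-- The action of a matrix on vector matrices, by the matrix itself on the first vector and by its
cofactors on the second one. -/
def slMap (P : Fin 3 → Fin 3 → ℂ) : Zorn →ₗ[ℂ] Zorn where
  toFun z := (z.1, z.2.1, fun i => P i 0 * z.2.2.1 0 + P i 1 * z.2.2.1 1 + P i 2 * z.2.2.1 2,
    fun i => cofactor P i 0 * z.2.2.2 0 + cofactor P i 1 * z.2.2.2 1 + cofactor P i 2 * z.2.2.2 2)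
  map_add' z w := by
    rw [zorn_ext_iff]
    simp only [Prod.fst_add, Prod.snd_add, Pi.add_apply]
    refine ⟨trivial, trivial, ⟨?_, ?_, ?_⟩, ?_, ?_, ?_⟩ <;> ring
  map_smul' c z := by
    rw [zorn_ext_iff]
    simp only [Prod.smul_fst, Prod.smul_snd, Pi.smul_apply, smul_eq_mul, RingHom.id_apply]
    refine ⟨trivial, trivial, ⟨?_, ?_, ?_⟩, ?_, ?_, ?_⟩ <;> ring

theorem slMap_apply (P : Fin 3 → Fin 3 → ℂ) (z : Zorn) : slMap P z =
    (z.1, z.2.1, fun i => P i 0 * z.2.2.1 0 + P i 1 * z.2.2.1 1 + P i 2 * z.2.2.1 2,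
    fun i => cofactor P i 0 * z.2.2.2 0 + cofactor P i 1 * z.2.2.2 1 + cofactor P i 2 * z.2.2.2 2) :=
  rfl

theorem cofactor_coord (P : Fin 3 → Fin 3 → ℂ) :
    (cofactor P 0 0 = P 1 1 * P 2 2 - P 1 2 * P 2 1 ∧
     cofactor P 0 1 = P 1 2 * P 2 0 - P 1 0 * P 2 2 ∧
     cofactor P 0 2 = P 1 0 * P 2 1 - P 1 1 * P 2 0) ∧
    (cofactor P 1 0 = P 2 1 * P 0 2 - P 2 2 * P 0 1 ∧
     cofactor P 1 1 = P 2 2 * P 0 0 - P 2 0 * P 0 2 ∧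
     cofactor P 1 2 = P 2 0 * P 0 1 - P 2 1 * P 0 0) ∧
    (cofactor P 2 0 = P 0 1 * P 1 2 - P 0 2 * P 1 1 ∧
     cofactor P 2 1 = P 0 2 * P 1 0 - P 0 0 * P 1 2 ∧
     cofactor P 2 2 = P 0 0 * P 1 1 - P 0 1 * P 1 0) :=
  ⟨⟨rfl, rfl, rfl⟩, ⟨rfl, rfl, rfl⟩, rfl, rfl, rfl⟩

/-- For determinant one the cofactor matrix is the inverse transpose. It preserves the pairing of
the two vectors and is compatible with both cross products. -/
theorem slMap_zmul (P : Fin 3 → Fin 3 → ℂ)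
    (hP : P 0 0 * P 1 1 * P 2 2 - P 0 0 * P 1 2 * P 2 1 - P 0 1 * P 1 0 * P 2 2
      + P 0 1 * P 1 2 * P 2 0 + P 0 2 * P 1 0 * P 2 1 - P 0 2 * P 1 1 * P 2 0 = 1) (z w : Zorn) :
    slMap P (zmul z w) = zmul (slMap P z) (slMap P w) := by
  obtain ⟨⟨x0, x1, x2⟩, y0, y1, y2⟩ := zmul_coord z w
  obtain ⟨⟨x0', x1', x2'⟩, y0', y1', y2'⟩ := zmul_coord (slMap P z) (slMap P w)
  obtain ⟨⟨c00, c01, c02⟩, ⟨c10, c11, c12⟩, c20, c21, c22⟩ := cofactor_coord P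
  rw [zorn_ext_iff, x0', x1', x2', y0', y1', y2', zmul_fst, zmul_snd]
  simp only [slMap_apply, c00, c01, c02, c10, c11, c12, c20, c21, c22, x0, x1, x2, y0, y1, y2,
    zmul_fst, zmul_snd]
  refine ⟨?_, ?_, ⟨?_, ?_, ?_⟩, ?_, ?_, ?_⟩
  · linear_combination (z.2.2.1 0 * w.2.2.2 0 + z.2.2.1 1 * w.2.2.2 1 + z.2.2.1 2 * w.2.2.2 2) * hP
  · linear_combination (w.2.2.1 0 * z.2.2.2 0 + w.2.2.1 1 * z.2.2.2 1 + w.2.2.1 2 * z.2.2.2 2) * hP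
  · linear_combination -(P 0 0 * (z.2.2.2 1 * w.2.2.2 2 - z.2.2.2 2 * w.2.2.2 1)
      + P 0 1 * (z.2.2.2 2 * w.2.2.2 0 - z.2.2.2 0 * w.2.2.2 2)
      + P 0 2 * (z.2.2.2 0 * w.2.2.2 1 - z.2.2.2 1 * w.2.2.2 0)) * hP
  · linear_combination -(P 1 0 * (z.2.2.2 1 * w.2.2.2 2 - z.2.2.2 2 * w.2.2.2 1)
      + P 1 1 * (z.2.2.2 2 * w.2.2.2 0 - z.2.2.2 0 * w.2.2.2 2)
      + P 1 2 * (z.2.2.2 0 * w.2.2.2 1 - z.2.2.2 1 * w.2.2.2 0)) * hP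
  · linear_combination -(P 2 0 * (z.2.2.2 1 * w.2.2.2 2 - z.2.2.2 2 * w.2.2.2 1)
      + P 2 1 * (z.2.2.2 2 * w.2.2.2 0 - z.2.2.2 0 * w.2.2.2 2)
      + P 2 2 * (z.2.2.2 0 * w.2.2.2 1 - z.2.2.2 1 * w.2.2.2 0)) * hP
  all_goals ring

theorem slMap_injective (P : Fin 3 → Fin 3 → ℂ)
    (hP : P 0 0 * P 1 1 * P 2 2 - P 0 0 * P 1 2 * P 2 1 - P 0 1 * P 1 0 * P 2 2
      + P 0 1 * P 1 2 * P 2 0 + P 0 2 * P 1 0 * P 2 1 - P 0 2 * P 1 1 * P 2 0 = 1) :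
    Function.Injective (slMap P) := by
  refine (injective_iff_map_eq_zero _).2 fun z hz => ?_
  obtain ⟨⟨c00, c01, c02⟩, ⟨c10, c11, c12⟩, c20, c21, c22⟩ := cofactor_coord P
  rw [zorn_ext_iff] at hz ⊢
  simp only [slMap_apply, c00, c01, c02, c10, c11, c12, c20, c21, c22, Prod.fst_zero,
    Prod.snd_zero, Pi.zero_apply] at hz ⊢
  obtain ⟨h1, h2, ⟨x0, x1, x2⟩, y0, y1, y2⟩ := hz
  refine ⟨h1, h2, ⟨?_, ?_, ?_⟩, ?_, ?_, ?_⟩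
  · linear_combination (P 1 1 * P 2 2 - P 1 2 * P 2 1) * x0 + (P 2 1 * P 0 2 - P 2 2 * P 0 1) * x1
      + (P 0 1 * P 1 2 - P 0 2 * P 1 1) * x2 - z.2.2.1 0 * hP
  · linear_combination (P 1 2 * P 2 0 - P 1 0 * P 2 2) * x0 + (P 2 2 * P 0 0 - P 2 0 * P 0 2) * x1
      + (P 0 2 * P 1 0 - P 0 0 * P 1 2) * x2 - z.2.2.1 1 * hP
  · linear_combination (P 1 0 * P 2 1 - P 1 1 * P 2 0) * x0 + (P 2 0 * P 0 1 - P 2 1 * P 0 0) * x1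
      + (P 0 0 * P 1 1 - P 0 1 * P 1 0) * x2 - z.2.2.1 2 * hP
  · linear_combination P 0 0 * y0 + P 1 0 * y1 + P 2 0 * y2 - z.2.2.2 0 * hP
  · linear_combination P 0 1 * y0 + P 1 1 * y1 + P 2 1 * y2 - z.2.2.2 1 * hP
  · linear_combination P 0 2 * y0 + P 1 2 * y1 + P 2 2 * y2 - z.2.2.2 2 * hP

/-! ### Semisimple automorphisms -/

instance : FiniteDimensional ℂ ComplexOctonion :=
  inferInstanceAs (FiniteDimensional ℂ (ℂ × (ZMod 7 → ℂ)))

theorem toEnd_apply (g : G₂) (x : ComplexOctonion) : toEnd g x = g.1 x := rfl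

/-- Over ℂ a semisimple map is diagonalizable, so a linear condition need only be checked on
eigenvectors. -/
theorem eq_top_of_eigenvectors_mem {g : G₂} (hg : (toEnd g).IsSemisimple)
    (N : Submodule ℂ ComplexOctonion) (hN : ∀ (μ : ℂ) x, g.1 x = μ • x → x ∈ N) : N = ⊤ := by
  rw [eq_top_iff, ← hg.iSup_eigenspace_eq_top]
  exact iSup_le fun μ x hx => hN μ x (Module.End.mem_eigenspace_iff.1 hx)

theorem eq_zero_of_form_e {x : ComplexOctonion} (h0 : x.re = 0) (h : ∀ k, form x (e k) = 0) :
    x = 0 := by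
  ext k
  · exact h0
  · rw [← form_e, h k]; rfl

/-- Invariance of trace and norm forces `x` to be imaginary and isotropic. By nondegeneracy some
eigenvector `y` is not orthogonal to it, and its eigenvalue must be 1/μ. Then xy is fixed, and its
imaginary part has norm -⟨x, y⟩². -/
theorem exists_fixed_of_eigenvalue {g : G₂} (hg : (toEnd g).IsSemisimple) {μ : ℂ}
    {x : ComplexOctonion} (hx : x ≠ 0) (hgx : g.1 x = μ • x) (hμ : μ ^ 2 ≠ 1) :
    ∃ w : ComplexOctonion, w.re = 0 ∧ n w ≠ 0 ∧ g.1 w = w := by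
  have hμ1 : μ - 1 ≠ 0 := fun h => hμ (by rw [sub_eq_zero.1 h, one_pow])
  have hre : x.re = 0 := by
    have h := re_map_G₂ g x
    rw [hgx, re_smul] at h
    exact (mul_eq_zero.1 (show (μ - 1) * x.re = 0 by linear_combination h)).resolve_left hμ1
  have hn : n x = 0 := by
    have h := n_map_G₂ g x
    rw [hgx, n_smul] at h
    exact (mul_eq_zero.1 (show (μ ^ 2 - 1) * n x = 0 by linear_combination h)).resolve_left
      (sub_ne_zero.2 hμ)
  obtain ⟨ν, y, hgy, hxy⟩ : ∃ (ν : ℂ) (y : ComplexOctonion), g.1 y = ν • y ∧ form x y ≠ 0 := by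
    by_contra! h
    have htop := eq_top_of_eigenvectors_mem hg (LinearMap.ker (formLeft x)) fun ν y hy => h ν y hy
    refine hx (eq_zero_of_form_e hre fun k => ?_)
    exact (htop ▸ Submodule.mem_top : e k ∈ LinearMap.ker (formLeft x))
  have hμν : μ * ν = 1 := by
    have h := form_map_G₂ g x y
    rw [hgx, hgy, form_smul_left, form_smul_right] at h
    exact mul_right_cancel₀ hxy (by linear_combination h)
  have hxyre : (x * y).re = -form x y := re_mul_of_re_eq_zero hre
  refine ⟨x * y + form x y • 1, ?_, ?_, ?_⟩
  · rw [re_add, hxyre, re_smul, re_one]; ring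
  · rw [n_add, n_mul, hn, n_smul, form_smul_right, form_comm _ 1, form_one_left, hxyre, n_eq 1,
      form_one_left, re_one]
    have h : -form x y ^ 2 ≠ 0 := neg_ne_zero.2 (pow_ne_zero 2 hxy)
    intro h'
    exact h (by linear_combination h')
  · rw [map_add, map_mul_G₂, hgx, hgy, map_smul, map_one_G₂, smul_mul_assoc, mul_smul_comm,
      smul_smul, hμν, one_smul]

/-- All x + gx are fixed. If one of them is nonzero but isotropic, it pairs nontrivially with
another one, and either that one or their sum is not isotropic. -/
theorem exists_fixed_of_involutive {g : G₂} (hg : ∀ x, g.1 (g.1 x) = x) :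
    ∃ w : ComplexOctonion, w.re = 0 ∧ n w ≠ 0 ∧ g.1 w = w := by
  have hfix : ∀ x, g.1 (x + g.1 x) = x + g.1 x := fun x => by rw [map_add, hg, add_comm]
  have hre : ∀ k, (e k + g.1 (e k)).re = 0 := fun k => by
    rw [re_add, re_map_G₂, e_re, add_zero]
  obtain ⟨k, hk⟩ : ∃ k, e k + g.1 (e k) ≠ 0 := by
    by_contra! h
    have h' : ∀ k, g.1 (e k) = -e k := fun k => eq_neg_of_add_eq_zero_right (h k)
    -- An automorphism cannot be -1 on V: it would fix e₀e₁ = e₃.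
    have h1 := map_mul_G₂ g (e 0) (e (0 + 1))
    rw [e_mul_e_succ, h', h', h', neg_mul_neg, e_mul_e_succ] at h1
    have h2 := congrArg (fun x => x.im (0 + 3)) h1
    simp only [im_neg, Pi.neg_apply, e_im, if_true] at h2
    norm_num at h2
  by_cases hnk : n (e k + g.1 (e k)) = 0
  · obtain ⟨j, hj⟩ : ∃ j, form (e k + g.1 (e k)) (e j) ≠ 0 := by
      by_contra! h
      exact hk (eq_zero_of_form_e (hre k) h)
    have hw := hfix (e k)
    have hw0 := hre k
    generalize e k + g.1 (e k) = w at *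
    have hform : form w (e j + g.1 (e j)) ≠ 0 := by
      have h : form w (g.1 (e j)) = form w (e j) := by
        conv_lhs => rw [← hw, form_map_G₂]
      rw [form_add_right, h, ← two_mul]
      exact mul_ne_zero two_ne_zero hj
    by_cases hnj : n (e j + g.1 (e j)) = 0
    · refine ⟨w + (e j + g.1 (e j)), ?_, ?_, ?_⟩
      · rw [re_add, hre, hw0, add_zero]
      · rw [n_add, hnk, hnj, zero_add, add_zero]
        exact mul_ne_zero two_ne_zero hform
      · rw [map_add, hw, hfix]
    · exact ⟨_, hre j, hnj, hfix _⟩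
  · exact ⟨_, hre k, hnk, hfix _⟩

theorem exists_fixed_quadric {g : G₂} (hg : (toEnd g).IsSemisimple) :
    ∃ v : quadric, actQuadric g v = v := by
  suffices ∃ w : ComplexOctonion, w.re = 0 ∧ n w ≠ 0 ∧ g.1 w = w by
    obtain ⟨w, hw0, hn, hgw⟩ := this
    have hc : (((3 / n w) ^ ((2 : ℕ) : ℂ)⁻¹ : ℂ)) ^ 2 = 3 / n w :=
      Complex.cpow_nat_inv_pow _ two_ne_zero
    generalize ((3 / n w) ^ ((2 : ℕ) : ℂ)⁻¹ : ℂ) = c at hc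
    refine ⟨⟨⟨c • w, by rw [mem_V, re_smul, hw0, mul_zero]⟩, ?_⟩, ?_⟩
    · change n (c • w) = 3
      rw [n_smul, hc, div_mul_cancel₀ _ hn]
    · refine Subtype.ext (Subtype.ext ?_)
      change g.1 (c • w) = c • w
      rw [map_smul, hgw]
  -- If all eigenvalues are ±1, diagonalizability makes `g` an involution or the identity.
  by_cases h : ∃ (μ : ℂ) (x : ComplexOctonion), x ≠ 0 ∧ g.1 x = μ • x ∧ μ ^ 2 ≠ 1
  · obtain ⟨μ, x, hx, hgx, hμ⟩ := h
    exact exists_fixed_of_eigenvalue hg hx hgx hμ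
  · push Not at h
    refine exists_fixed_of_involutive fun x => ?_
    have htop := eq_top_of_eigenvectors_mem hg
      (LinearMap.eqLocus ((toEnd g) ∘ₗ (toEnd g)) LinearMap.id) fun μ x hx => by
        change g.1 (g.1 x) = x
        by_cases hx0 : x = 0
        · rw [hx0, map_zero, map_zero]
        · rw [hx, map_smul, hx, smul_smul, ← sq, h μ x hx0 hx, one_smul]
    exact (htop ▸ Submodule.mem_top :
      x ∈ LinearMap.eqLocus ((toEnd g) ∘ₗ (toEnd g)) LinearMap.id)

/-! ### Diagonalization of a semisimple automorphism that fixes e₀ -/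

/-- The first vector of a vector matrix. -/
def zornVec : (Fin 3 → ℂ) →ₗ[ℂ] Zorn where
  toFun x := (0, 0, x, 0)
  map_add' x y := by simp
  map_smul' c x := by simp

theorem zornVec_apply (x : Fin 3 → ℂ) : zornVec x = (0, 0, x, 0) := rfl

theorem zorn_idempotents :
    zorn (1, 0, 0, 0) = (1 / 2 : ℂ) • 1 + (Complex.I / 2) • e 0 ∧
    zorn (0, 1, 0, 0) = (1 / 2 : ℂ) • 1 - (Complex.I / 2) • e 0 := by
  rw [ext_iff_seven, ext_iff_seven]
  simp +decide [zorn_re, zorn_im_zero, zorn_im_one, zorn_im_two, zorn_im_three, zorn_im_four,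
    zorn_im_five, zorn_im_six, e_re, e_im, re_sub, im_sub]

theorem e_zero_eq_zorn : e 0 = zorn (-Complex.I, Complex.I, 0, 0) := by
  have h : ((-Complex.I, Complex.I, 0, 0) : Zorn)
      = (-Complex.I) • (1, 0, 0, 0) + Complex.I • (0, 1, 0, 0) := by simp
  have h1 : e 0 = (-Complex.I * Complex.I) • e 0 := by
    rw [neg_mul, Complex.I_mul_I, neg_neg, one_smul]
  rw [h, map_add, map_smul, map_smul, zorn_idempotents.1, zorn_idempotents.2]
  conv_lhs => rw [h1]
  module

theorem zmul_peirce (z : Zorn) :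
    zmul (zmul (1, 0, 0, 0) z) (0, 1, 0, 0) = zornVec z.2.2.1 := by
  rw [zorn_ext_iff]
  simp [zmul, zornVec_apply]

/-- Fixing e₀ means fixing both diagonal idempotents, so `g` commutes with the Peirce projection of
`zmul_peirce`. The projections of eigenvectors are again eigenvectors and span the Peirce space. -/
theorem exists_eigenbasis {g : G₂} (hg : (toEnd g).IsSemisimple) (h0 : g.1 (e 0) = e 0) :
    ∃ (b : Module.Basis (Fin 3) ℂ (Fin 3 → ℂ)) (c : Fin 3 → ℂ),
      ∀ i, g.1 (zorn (zornVec (b i))) = c i • zorn (zornVec (b i)) := by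
  have hp : g.1 (zorn (1, 0, 0, 0)) = zorn (1, 0, 0, 0) := by
    rw [zorn_idempotents.1, map_add, map_smul, map_smul, map_one_G₂, h0]
  have hm : g.1 (zorn (0, 1, 0, 0)) = zorn (0, 1, 0, 0) := by
    rw [zorn_idempotents.2, map_sub, map_smul, map_smul, map_one_G₂, h0]
  let E : Set (Fin 3 → ℂ) := {x | ∃ c : ℂ, g.1 (zorn (zornVec x)) = c • zorn (zornVec x)}
  let pr : ComplexOctonion →ₗ[ℂ] (Fin 3 → ℂ) :=
    LinearMap.fst ℂ _ _ ∘ₗ LinearMap.snd ℂ _ _ ∘ₗ LinearMap.snd ℂ _ _ ∘ₗ zorn.symm.toLinearMap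
  have hpr : ∀ z, pr (zorn z) = z.2.2.1 := fun z => by
    change (zorn.symm (zorn z)).2.2.1 = _
    rw [zorn.symm_apply_apply]
  have htop := eq_top_of_eigenvectors_mem hg ((Submodule.span ℂ E).comap pr) fun μ q hq => by
    obtain ⟨z, rfl⟩ := zorn.surjective q
    rw [Submodule.mem_comap, hpr]
    refine Submodule.subset_span ⟨μ, ?_⟩
    rw [← zmul_peirce, zorn_zmul, zorn_zmul, map_mul_G₂, map_mul_G₂, hp, hm, hq, mul_smul_comm,
      smul_mul_assoc]
  have hspan : ⊤ ≤ Submodule.span ℂ E := fun x _ => by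
    have h : zorn (zornVec x) ∈ (Submodule.span ℂ E).comap pr := htop ▸ Submodule.mem_top
    rwa [Submodule.mem_comap, hpr] at h
  let b := Module.Basis.ofSpan hspan
  have hb : ∀ i, b i ∈ E := fun i => Module.Basis.ofSpan_subset hspan ⟨i, rfl⟩
  let σ := b.indexEquiv (Pi.basisFun ℂ (Fin 3))
  choose c hc using fun i => hb (σ.symm i)
  refine ⟨b.reindex σ, c, fun i => ?_⟩
  rw [b.reindex_apply]
  exact hc i

/-- The diagonal action on vector matrices. -/
def diagMap (c : Fin 3 → ℂ) (z : Zorn) : Zorn :=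
  (z.1, z.2.1, fun i => c i * z.2.2.1 i, fun i => c (i + 1) * c (i + 2) * z.2.2.2 i)

/-- The second vectors are products of first ones, so an automorphism fixing the idempotents is
determined by its values on the first vectors. -/
theorem zorn_decomp (z : Zorn) : z = z.1 • (1, 0, 0, 0) + z.2.1 • (0, 1, 0, 0)
    + (z.2.2.1 0 • zornVec (Pi.single 0 1) + z.2.2.1 1 • zornVec (Pi.single 1 1)
      + z.2.2.1 2 • zornVec (Pi.single 2 1))
    + (z.2.2.2 0 • zmul (zornVec (Pi.single 1 1)) (zornVec (Pi.single 2 1))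
      + z.2.2.2 1 • zmul (zornVec (Pi.single 2 1)) (zornVec (Pi.single 0 1))
      + z.2.2.2 2 • zmul (zornVec (Pi.single 0 1)) (zornVec (Pi.single 1 1))) := by
  rw [zorn_ext_iff]
  simp +decide [zmul, zornVec_apply, Pi.single_apply]

theorem map_zorn_eq_diagMap {g : G₂} (h0 : g.1 (e 0) = e 0) (c : Fin 3 → ℂ)
    (hc : ∀ i, g.1 (zorn (zornVec (Pi.single i 1))) = c i • zorn (zornVec (Pi.single i 1))) :
    c 0 * c 1 * c 2 = 1 ∧ ∀ z, g.1 (zorn z) = zorn (diagMap c z) := by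
  have hp : g.1 (zorn (1, 0, 0, 0)) = zorn (1, 0, 0, 0) := by
    rw [zorn_idempotents.1, map_add, map_smul, map_smul, map_one_G₂, h0]
  have hm : g.1 (zorn (0, 1, 0, 0)) = zorn (0, 1, 0, 0) := by
    rw [zorn_idempotents.2, map_sub, map_smul, map_smul, map_one_G₂, h0]
  have hy : ∀ i j, g.1 (zorn (zmul (zornVec (Pi.single i 1)) (zornVec (Pi.single j 1))))
      = (c i * c j) • zorn (zmul (zornVec (Pi.single i 1)) (zornVec (Pi.single j 1))) :=
    fun i j => by
      rw [zorn_zmul, map_mul_G₂, hc, hc, smul_mul_assoc, mul_smul_comm, smul_smul]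
  constructor
  · have h1 : zmul (zornVec (Pi.single 0 1))
        (zmul (zornVec (Pi.single 1 1)) (zornVec (Pi.single 2 1))) = -(1, 0, 0, 0) := by
      rw [zorn_ext_iff]
      simp +decide [zmul, zornVec_apply, Pi.single_apply]
    have h2 := congrArg (fun z => g.1 (zorn z)) h1
    rw [zorn_zmul, map_mul_G₂, hc, hy, smul_mul_assoc, mul_smul_comm, smul_smul, ← zorn_zmul, h1,
      map_neg, map_neg, hp, ← map_neg, ← map_smul] at h2
    have h3 := congrArg Prod.fst (zorn.injective h2)
    simp only [Prod.smul_fst, Prod.fst_neg, smul_eq_mul] at h3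
    linear_combination -h3
  · intro z
    conv_lhs => rw [zorn_decomp z]
    simp only [map_add, map_smul, hp, hm, hc, hy]
    simp only [← map_smul, ← map_add]
    congr 1
    rw [zorn_ext_iff]
    simp +decide [zmul, zornVec_apply, Pi.single_apply, diagMap]
    refine ⟨⟨?_, ?_, ?_⟩, ?_, ?_, ?_⟩ <;> ring

theorem exists_conj_diagMap {g : G₂} (hg : (toEnd g).IsSemisimple) (h0 : g.1 (e 0) = e 0) :
    ∃ (h : G₂) (c : Fin 3 → ℂ), c 0 * c 1 * c 2 = 1 ∧
      ∀ z, (h⁻¹ * g * h).1 (zorn z) = zorn (diagMap c z) := by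
  obtain ⟨b, c, hb⟩ := exists_eigenbasis hg h0
  have hD : (Matrix.of fun i j => b j i).det ≠ 0 := by
    have h := Matrix.linearIndependent_cols_iff_isUnit.1
      (show LinearIndependent ℂ (Matrix.of fun i j => b j i).col from b.linearIndependent)
    exact ((Matrix.isUnit_iff_isUnit_det _).1 h).ne_zero
  rw [Matrix.det_fin_three] at hD
  simp only [Matrix.of_apply] at hD
  generalize hDe : b 0 0 * b 1 1 * b 2 2 - b 0 0 * b 2 1 * b 1 2 - b 1 0 * b 0 1 * b 2 2
    + b 1 0 * b 2 1 * b 0 2 + b 2 0 * b 0 1 * b 1 2 - b 2 0 * b 1 1 * b 0 2 = D at hD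
  -- Rescaling one eigenvector by the inverse determinant gives a matrix `P` of determinant one
  -- whose columns are still eigenvectors.
  let t : Fin 3 → ℂ := ![D⁻¹, 1, 1]
  let P : Fin 3 → Fin 3 → ℂ := fun i j => t j * b j i
  have hP : P 0 0 * P 1 1 * P 2 2 - P 0 0 * P 1 2 * P 2 1 - P 0 1 * P 1 0 * P 2 2
      + P 0 1 * P 1 2 * P 2 0 + P 0 2 * P 1 0 * P 2 1 - P 0 2 * P 1 1 * P 2 0 = 1 := by
    change D⁻¹ * b 0 0 * (1 * b 1 1) * (1 * b 2 2) - D⁻¹ * b 0 0 * (1 * b 2 1) * (1 * b 1 2)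
      - 1 * b 1 0 * (D⁻¹ * b 0 1) * (1 * b 2 2) + 1 * b 1 0 * (1 * b 2 1) * (D⁻¹ * b 0 2)
      + 1 * b 2 0 * (D⁻¹ * b 0 1) * (1 * b 1 2) - 1 * b 2 0 * (1 * b 1 1) * (D⁻¹ * b 0 2) = 1
    linear_combination D⁻¹ * hDe + mul_inv_cancel₀ hD
  let h := zornAut (LinearEquiv.ofInjectiveEndo (slMap P) (slMap_injective P hP)) (slMap_zmul P hP)
  have hh : ∀ z, h.1 (zorn z) = zorn (slMap P z) := fun z => zornAut_apply _ _ z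
  have hcol : ∀ j, h.1 (zorn (zornVec (Pi.single j 1))) = t j • zorn (zornVec (b j)) := fun j => by
    rw [hh, ← map_smul, ← map_smul]
    congr 1
    rw [slMap_apply, zorn_ext_iff]
    fin_cases j <;> simp +decide [zornVec_apply, P]
  have he : h.1 (e 0) = e 0 := by
    rw [e_zero_eq_zorn, hh]
    congr 1
    rw [slMap_apply, zorn_ext_iff]
    simp
  have hinv : ∀ x, (h⁻¹).1 (h.1 x) = x := fun x => h.1.symm_apply_apply x
  refine ⟨h, c, map_zorn_eq_diagMap ?_ c fun i => ?_⟩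
  · change (h⁻¹).1 (g.1 (h.1 (e 0))) = e 0
    rw [he, h0]
    conv_lhs => rw [← he]
    exact hinv _
  · change (h⁻¹).1 (g.1 (h.1 (zorn (zornVec (Pi.single i 1))))) = _
    rw [hcol, map_smul, hb, smul_comm, ← hcol, map_smul, hinv]

end ComplexOctonion

/-! ### Exponentials of derivations -/

theorem exp_mul_exp_neg_of_complex {A : Type*} [NormedRing A] [NormedAlgebra ℂ A] [CompleteSpace A]
    (x : A) : NormedSpace.exp x * NormedSpace.exp (-x) = 1 := by
  let _ : NormedAlgebra ℚ A := NormedAlgebra.restrictScalars ℚ ℂ A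
  rw [← NormedSpace.exp_add_of_commute (Commute.neg_right rfl), add_neg_cancel,
    NormedSpace.exp_zero]

/-- The exponential of a derivation is multiplicative. -/
theorem exp_derivation_mul {E : Type*} [NormedAddCommGroup E] [NormedSpace ℂ E] [CompleteSpace E]
    (B : E →L[ℂ] E →L[ℂ] E) (D : E →L[ℂ] E) (hD : ∀ x y, D (B x y) = B (D x) y + B x (D y))
    (x y : E) : NormedSpace.exp D (B x y) = B (NormedSpace.exp D x) (NormedSpace.exp D y) := by
  have hd : ∀ (z : E) (t : ℂ), HasDerivAt (fun s : ℂ => NormedSpace.exp (s • D) z)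
      (D (NormedSpace.exp (t • D) z)) t := fun z t =>
    ((hasDerivAt_exp_smul_const' D t).clm_apply (hasDerivAt_const t z)).congr_deriv (by simp)
  have hB : ∀ t : ℂ, HasDerivAt
      (fun s : ℂ => B (NormedSpace.exp (s • D) x) (NormedSpace.exp (s • D) y))
      (D (B (NormedSpace.exp (t • D) x) (NormedSpace.exp (t • D) y))) t := fun t => by
    rw [hD]
    exact (B.hasFDerivAt.comp_hasDerivAt t (hd x t)).clm_apply (hd y t)
  -- Transporting the product back by exp(-tD) gives a function of `t` with zero derivative; its
  -- values at 1 and 0 are compared.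
  have h : ∀ t : ℂ, HasDerivAt (fun s : ℂ => NormedSpace.exp (s • -D)
      (B (NormedSpace.exp (s • D) x) (NormedSpace.exp (s • D) y))) 0 t := fun t =>
    ((hasDerivAt_exp_smul_const (-D) t).clm_apply (hB t)).congr_deriv (by simp)
  have h1 := is_const_of_deriv_eq_zero (fun t => (h t).differentiableAt) (fun t => (h t).deriv) 1 0
  simp only [one_smul, zero_smul, NormedSpace.exp_zero, one_apply_eq_self] at h1
  rw [← h1, ← mul_apply_eq_comp, exp_mul_exp_neg_of_complex,
    one_apply_eq_self]

/-- The tangent directions to a conjugation orbit are commutators. Strictness of the derivative is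
what the open mapping argument needs. -/
theorem exists_hasStrictFDerivAt_exp_conj {E A : Type*} [NormedAddCommGroup E] [NormedSpace ℂ E]
    [NormedRing A] [NormedAlgebra ℂ A] [CompleteSpace A] (δ : E →L[ℂ] A) (d : A) :
    ∃ f' : E →L[ℂ] A, (∀ m, f' m = δ m * d - d * δ m) ∧
      HasStrictFDerivAt (fun m => NormedSpace.exp (δ m) * d * NormedSpace.exp (-δ m)) f' 0 := by
  have hexp : ∀ ε : E →L[ℂ] A, HasStrictFDerivAt (fun m => NormedSpace.exp (ε m)) ε 0 := fun ε => by
    have h := hasStrictFDerivAt_exp_zero (𝕂 := ℂ) (𝔸 := A)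
    rw [← map_zero ε] at h
    exact h.comp 0 ε.hasStrictFDerivAt
  refine ⟨_, fun m => ?_, ((hexp δ).mul' (hasStrictFDerivAt_const d 0)).mul' (hexp (-δ))⟩
  simp [NormedSpace.exp_zero, sub_eq_neg_add]

/-! ### Root derivations and the dimension of the class of a diagonal automorphism -/

namespace ComplexOctonion

/-- The product of vector matrices as a continuous bilinear map. -/
noncomputable def zmulL : Zorn →L[ℂ] Zorn →L[ℂ] Zorn :=
  LinearMap.toContinuousBilinearMap <| LinearMap.mk₂ ℂ zmul
    (fun z z' w => by
      rw [zorn_ext_iff]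
      simp only [zmul, Prod.fst_add, Prod.snd_add, Pi.add_apply]
      refine ⟨?_, ?_, ⟨?_, ?_, ?_⟩, ?_, ?_, ?_⟩ <;> ring)
    (fun c z w => by
      rw [zorn_ext_iff]
      simp only [zmul, Prod.smul_fst, Prod.smul_snd, Pi.smul_apply, smul_eq_mul]
      refine ⟨?_, ?_, ⟨?_, ?_, ?_⟩, ?_, ?_, ?_⟩ <;> ring)
    (fun z w w' => by
      rw [zorn_ext_iff]
      simp only [zmul, Prod.fst_add, Prod.snd_add, Pi.add_apply]
      refine ⟨?_, ?_, ⟨?_, ?_, ?_⟩, ?_, ?_, ?_⟩ <;> ring)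
    (fun c z w => by
      rw [zorn_ext_iff]
      simp only [zmul, Prod.smul_fst, Prod.smul_snd, Pi.smul_apply, smul_eq_mul]
      refine ⟨?_, ?_, ⟨?_, ?_, ?_⟩, ?_, ?_, ?_⟩ <;> ring)

/-- The coefficients of the root vectors of the Lie algebra `𝔤₂`: the short positive ones, the short
negative ones, and the long ones (at the off-diagonal entries). -/
abbrev RootCoeff : Type := (Fin 3 → ℂ) × (Fin 3 → ℂ) × (Fin 3 → Fin 3 → ℂ)

/-- The derivation of the algebra of vector matrices with given coefficients. -/
def derFun (m : RootCoeff) (z : Zorn) : Zorn :=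
  (m.1 0 * z.2.2.2 0 + m.1 1 * z.2.2.2 1 + m.1 2 * z.2.2.2 2
      - (m.2.1 0 * z.2.2.1 0 + m.2.1 1 * z.2.2.1 1 + m.2.1 2 * z.2.2.1 2),
   m.2.1 0 * z.2.2.1 0 + m.2.1 1 * z.2.2.1 1 + m.2.1 2 * z.2.2.1 2
      - (m.1 0 * z.2.2.2 0 + m.1 1 * z.2.2.2 1 + m.1 2 * z.2.2.2 2),
   fun i => (z.1 - z.2.1) * m.1 i
      + (m.2.1 (i + 1) * z.2.2.2 (i + 2) - m.2.1 (i + 2) * z.2.2.2 (i + 1))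
      + (m.2.2 i (i + 1) * z.2.2.1 (i + 1) + m.2.2 i (i + 2) * z.2.2.1 (i + 2)),
   fun i => (z.2.1 - z.1) * m.2.1 i
      + (m.1 (i + 1) * z.2.2.1 (i + 2) - m.1 (i + 2) * z.2.2.1 (i + 1))
      - (m.2.2 (i + 1) i * z.2.2.2 (i + 1) + m.2.2 (i + 2) i * z.2.2.2 (i + 2)))

theorem fin_three_sums : (0 : Fin 3) + 1 = 1 ∧ (0 : Fin 3) + 2 = 2 ∧ (1 : Fin 3) + 1 = 2 ∧
    (1 : Fin 3) + 2 = 0 ∧ (2 : Fin 3) + 1 = 0 ∧ (2 : Fin 3) + 2 = 1 := by decide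

theorem derFun_zmul (m : RootCoeff) (z w : Zorn) :
    derFun m (zmul z w) = zmul (derFun m z) w + zmul z (derFun m w) := by
  obtain ⟨h1, h2, h3, h4, h5, h6⟩ := fin_three_sums
  rw [zorn_ext_iff]
  simp only [zmul, derFun, Prod.fst_add, Prod.snd_add, Pi.add_apply, h1, h2, h3, h4, h5, h6]
  refine ⟨?_, ?_, ⟨?_, ?_, ?_⟩, ?_, ?_, ?_⟩ <;> ring

/-- The derivations, as a linear map. -/
noncomputable def derL : RootCoeff →L[ℂ] Zorn →L[ℂ] Zorn :=
  LinearMap.toContinuousBilinearMap <| LinearMap.mk₂ ℂ derFun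
    (fun m m' z => by
      rw [zorn_ext_iff]
      simp only [derFun, Prod.fst_add, Prod.snd_add, Pi.add_apply]
      refine ⟨?_, ?_, ⟨?_, ?_, ?_⟩, ?_, ?_, ?_⟩ <;> ring)
    (fun c m z => by
      rw [zorn_ext_iff]
      simp only [derFun, Prod.smul_fst, Prod.smul_snd, Pi.smul_apply, smul_eq_mul]
      refine ⟨?_, ?_, ⟨?_, ?_, ?_⟩, ?_, ?_, ?_⟩ <;> ring)
    (fun m z z' => by
      rw [zorn_ext_iff]
      simp only [derFun, Prod.fst_add, Prod.snd_add, Pi.add_apply]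
      refine ⟨?_, ?_, ⟨?_, ?_, ?_⟩, ?_, ?_, ?_⟩ <;> ring)
    (fun c m z => by
      rw [zorn_ext_iff]
      simp only [derFun, Prod.smul_fst, Prod.smul_snd, Pi.smul_apply, smul_eq_mul]
      refine ⟨?_, ?_, ⟨?_, ?_, ?_⟩, ?_, ?_, ?_⟩ <;> ring)

theorem exp_derL_exp_neg (m : RootCoeff) (z : Zorn) :
    NormedSpace.exp (derL m) (NormedSpace.exp (-derL m) z) = z := by
  rw [← mul_apply_eq_comp, exp_mul_exp_neg_of_complex, one_apply_eq_self]

theorem exp_neg_derL_exp (m : RootCoeff) (z : Zorn) :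
    NormedSpace.exp (-derL m) (NormedSpace.exp (derL m) z) = z := by
  have h := exp_mul_exp_neg_of_complex (-derL m)
  rw [neg_neg] at h
  rw [← mul_apply_eq_comp, h, one_apply_eq_self]

/-- The exponential of a derivation, as an automorphism of the octonions. -/
noncomputable def expAut (m : RootCoeff) : G₂ :=
  zornAut { (NormedSpace.exp (derL m)).toLinearMap with
      invFun := (NormedSpace.exp (-derL m) : Zorn →L[ℂ] Zorn)
      left_inv := exp_neg_derL_exp m
      right_inv := exp_derL_exp_neg m }
    fun z w => exp_derivation_mul zmulL (derL m) (derFun_zmul m) z w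

theorem expAut_apply (m : RootCoeff) (z : Zorn) :
    (expAut m).1 (zorn z) = zorn (NormedSpace.exp (derL m) z) := zornAut_apply _ _ z

theorem expAut_inv_apply (m : RootCoeff) (z : Zorn) :
    ((expAut m)⁻¹).1 (zorn z) = zorn (NormedSpace.exp (-derL m) z) := by
  conv_lhs => rw [← exp_derL_exp_neg m z, ← expAut_apply]
  exact (expAut m).1.symm_apply_apply _

/-- The diagonal action on vector matrices, as a continuous linear map. -/
noncomputable def diagL (c : Fin 3 → ℂ) : Zorn →L[ℂ] Zorn :=
  LinearMap.toContinuousLinearMap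
    { toFun := diagMap c
      map_add' := fun z w => by
        rw [zorn_ext_iff]
        simp only [diagMap, Prod.fst_add, Prod.snd_add, Pi.add_apply]
        refine ⟨trivial, trivial, ⟨?_, ?_, ?_⟩, ?_, ?_, ?_⟩ <;> ring
      map_smul' := fun t z => by
        rw [zorn_ext_iff]
        simp only [diagMap, Prod.smul_fst, Prod.smul_snd, Pi.smul_apply, smul_eq_mul,
          RingHom.id_apply]
        refine ⟨trivial, trivial, ⟨?_, ?_, ?_⟩, ?_, ?_, ?_⟩ <;> ring }

theorem diagL_apply (c : Fin 3 → ℂ) (z : Zorn) : diagL c z = diagMap c z := rfl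

/-- The matrix entries of an endomorphism at the root vectors. -/
def rootEntry : (Zorn →ₗ[ℂ] Zorn) →ₗ[ℂ] RootCoeff where
  toFun S := ((S (1, 0, 0, 0)).2.2.1, (S (1, 0, 0, 0)).2.2.2,
    fun i j => (S (zornVec (Pi.single j 1))).2.2.1 i)
  map_add' _ _ := rfl
  map_smul' _ _ := rfl

/-- A diagonal automorphism scales each root space, so the commutator multiplies each root
coefficient by a factor that vanishes exactly when the root is trivial on it (given c₀c₁c₂ = 1, for
the short negative roots). -/
theorem rootEntry_commutator (c : Fin 3 → ℂ) (m : RootCoeff) :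
    rootEntry (derL m * diagL c - diagL c * derL m : Zorn →L[ℂ] Zorn).toLinearMap =
      (fun i => (1 - c i) * m.1 i, fun i => (c (i + 1) * c (i + 2) - 1) * m.2.1 i,
        fun i j => if i = j then 0 else (c j - c i) * m.2.2 i j) := by
  refine Prod.ext (funext fun i => ?_) (Prod.ext (funext fun i => ?_)
    (funext fun i => funext fun j => ?_))
  · change (derFun m (diagMap c (1, 0, 0, 0))).2.2.1 i - (diagMap c (derFun m (1, 0, 0, 0))).2.2.1 i
      = _
    simp [diagMap, derFun]
    ring
  · change (derFun m (diagMap c (1, 0, 0, 0))).2.2.2 i - (diagMap c (derFun m (1, 0, 0, 0))).2.2.2 i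
      = _
    simp [diagMap, derFun]
    ring
  · change (derFun m (diagMap c (zornVec (Pi.single j 1)))).2.2.1 i
      - (diagMap c (derFun m (zornVec (Pi.single j 1)))).2.2.1 i = _
    fin_cases i <;> fin_cases j <;> simp +decide [diagMap, derFun, zornVec_apply] <;> ring

theorem eventually_exists_rootEntry_eq (c : Fin 3 → ℂ) {ι : Type*} [Finite ι]
    (l : RootCoeff →ₗ[ℂ] (ι → ℂ))
    (hl : ∀ w, ∃ m : RootCoeff, l (fun i => (1 - c i) * m.1 i,
      fun i => (c (i + 1) * c (i + 2) - 1) * m.2.1 i,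
      fun i j => if i = j then 0 else (c j - c i) * m.2.2 i j) = w) :
    ∃ z : ι → ℂ, ∀ᶠ w in nhds z, ∃ m : RootCoeff, l (rootEntry (NormedSpace.exp (derL m) * diagL c *
      NormedSpace.exp (-derL m) : Zorn →L[ℂ] Zorn).toLinearMap) = w := by
  have := Fintype.ofFinite ι
  obtain ⟨f', hf', hf⟩ := exists_hasStrictFDerivAt_exp_conj derL (diagL c)
  let Λ : (Zorn →L[ℂ] Zorn) →L[ℂ] (ι → ℂ) :=
    LinearMap.toContinuousLinearMap (l ∘ₗ rootEntry ∘ₗ ContinuousLinearMap.coeLM ℂ)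
  -- A strictly differentiable map with surjective derivative is open at the point, so the values
  -- cover a neighbourhood.
  have h := (Λ.hasStrictFDerivAt.comp 0 hf).map_nhds_eq_of_surj (by
    rw [LinearMap.range_eq_top]
    intro w
    obtain ⟨m, hm⟩ := hl w
    refine ⟨m, ?_⟩
    rw [← hm, ← rootEntry_commutator, ← hf' m]
    rfl)
  refine ⟨Λ (NormedSpace.exp (derL 0) * diagL c * NormedSpace.exp (-derL 0)), ?_⟩
  rw [← h, Filter.eventually_map]
  exact Filter.Eventually.of_forall fun m => ⟨m, rfl⟩

theorem mul_apply_G₂ (g h : G₂) (x : ComplexOctonion) : (g * h).1 x = g.1 (h.1 x) := rfl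

theorem natCard_le_dim_classVariety (c : Fin 3 → ℂ) (d : G₂)
    (hd : ∀ z, d.1 (zorn z) = zorn (diagMap c z)) {ι : Type*} [Finite ι]
    (l : RootCoeff →ₗ[ℂ] (ι → ℂ))
    (hl : ∀ w, ∃ m : RootCoeff, l (fun i => (1 - c i) * m.1 i,
      fun i => (c (i + 1) * c (i + 2) - 1) * m.2.1 i,
      fun i j => if i = j then 0 else (c j - c i) * m.2.2 i j) = w) :
    (Nat.card ι : WithBot ℕ∞) ≤ dim (classVariety (ConjClasses.mk d)) := by
  have := Fintype.ofFinite ι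
  obtain ⟨z, hz⟩ := eventually_exists_rootEntry_eq c l hl
  let L : Module.End ℂ ComplexOctonion →ₗ[ℂ] (ι → ℂ) :=
    l ∘ₗ rootEntry ∘ₗ zorn.symm.conj.toLinearMap
  refine natCard_le_dim _ (fun i => (LinearMap.proj i : (ι → ℂ) →ₗ[ℂ] ℂ) ∘ₗ L) z (hz.mono ?_)
  rintro w ⟨m, rfl⟩
  refine ⟨_, ⟨expAut m * d * (expAut m)⁻¹, ?_, rfl⟩, fun i => ?_⟩
  · rw [ConjClasses.mem_carrier_iff_mk_eq, ConjClasses.mk_eq_mk_iff_isConj]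
    exact (isConj_iff.2 ⟨expAut m, rfl⟩).symm
  · have key : zorn.symm.conj (toEnd (expAut m * d * (expAut m)⁻¹)) =
        (NormedSpace.exp (derL m) * diagL c * NormedSpace.exp (-derL m) :
          Zorn →L[ℂ] Zorn).toLinearMap := by
      refine LinearMap.ext fun z => ?_
      rw [LinearEquiv.conj_apply_apply, LinearEquiv.symm_symm, toEnd_apply, mul_apply_G₂,
        mul_apply_G₂, expAut_inv_apply, hd, expAut_apply, zorn.symm_apply_apply,
        ContinuousLinearMap.coe_coe, mul_apply_eq_comp, mul_apply_eq_comp, diagL_apply]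
    exact congrFun (congrArg (fun S => l (rootEntry S)) key) i

/-- The indices of the roots that do not take the value `1` at the diagonal automorphism. -/
abbrev MovedRoot (c : Fin 3 → ℂ) : Type :=
  {i // c i ≠ 1} ⊕ {i // c i ≠ 1} ⊕ {p : Fin 3 × Fin 3 // c p.1 ≠ c p.2}

/-- If exactly two entries agree, their common value is not 1, and four short and four long roots
are moved. If all entries differ, all six long roots are moved, and some short ones as well. -/
theorem seven_le_card_movedRoot {c : Fin 3 → ℂ} (h1 : c 0 * c 1 * c 2 = 1)
    (hne : ¬(c 0 = c 1 ∧ c 0 = c 2)) : 7 ≤ Nat.card (MovedRoot c) := by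
  classical
  rw [Nat.card_eq_fintype_card, Fintype.card_sum, Fintype.card_sum, Fintype.card_subtype,
    Fintype.card_subtype, Finset.card_filter, Finset.card_filter, Fintype.sum_prod_type]
  simp only [Fin.sum_univ_three]
  generalize c 0 = x at *
  generalize c 1 = y at *
  generalize c 2 = z at *
  by_cases hxy : x = y
  · have hxz : x ≠ z := fun h => hne ⟨hxy, h⟩
    subst hxy
    have hx1 : x ≠ 1 := by
      rintro rfl
      exact hxz (by linear_combination -h1)
    simp [hxz, hxz.symm, hx1]
    omega
  · by_cases hxz : x = z
    · subst hxz
      have hx1 : x ≠ 1 := by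
        rintro rfl
        exact hxy (by linear_combination -h1)
      simp [hxy, Ne.symm hxy, hx1]
      omega
    · by_cases hyz : y = z
      · subst hyz
        have hy1 : y ≠ 1 := by
          rintro rfl
          exact hxy (by linear_combination h1)
        simp [hxy, Ne.symm hxy, hy1]
        omega
      · by_cases hx : x = 1
        · subst hx
          simp [hxy, hxz, hyz, Ne.symm hxy, Ne.symm hxz, Ne.symm hyz]
        · simp [hxy, hxz, hyz, Ne.symm hxy, Ne.symm hxz, Ne.symm hyz, hx]
          omega

theorem seven_le_dim_classVariety {c : Fin 3 → ℂ} (h1 : c 0 * c 1 * c 2 = 1)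
    (hne : ¬(c 0 = c 1 ∧ c 0 = c 2)) {d : G₂} (hd : ∀ z, d.1 (zorn z) = zorn (diagMap c z)) :
    7 ≤ dim (classVariety (ConjClasses.mk d)) := by
  classical
  let l : RootCoeff →ₗ[ℂ] (MovedRoot c → ℂ) :=
    { toFun := fun m => Sum.elim (fun i => m.1 i) (Sum.elim (fun i => m.2.1 i)
        (fun p => m.2.2 p.1.1 p.1.2))
      map_add' := fun m m' => by
        funext r; rcases r with r | r | r <;> rfl
      map_smul' := fun t m => by
        funext r; rcases r with r | r | r <;> rfl }
  refine le_trans ?_ (natCard_le_dim_classVariety c d hd l fun w => ?_)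
  · exact_mod_cast seven_le_card_movedRoot h1 hne
  have hc : ∀ i, c i * (c (i + 1) * c (i + 2)) = 1 := by
    intro i
    fin_cases i
    · exact (mul_assoc _ _ _).symm.trans h1
    · change c 1 * (c 2 * c 0) = 1
      linear_combination h1
    · change c 2 * (c 0 * c 1) = 1
      linear_combination h1
  -- Division by the nonzero commutator factors solves for the moved coefficients; the others do not
  -- enter and are set to 0.
  refine ⟨(fun i => if h : c i ≠ 1 then w (Sum.inl ⟨i, h⟩) / (1 - c i) else 0,
    fun i => if h : c i ≠ 1 then w (Sum.inr (Sum.inl ⟨i, h⟩)) / (c (i + 1) * c (i + 2) - 1) else 0,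
    fun i j => if h : c i ≠ c j then w (Sum.inr (Sum.inr ⟨(i, j), h⟩)) / (c j - c i) else 0), ?_⟩
  funext r
  rcases r with ⟨i, hi⟩ | ⟨i, hi⟩ | ⟨⟨i, j⟩, hij⟩
  · change (1 - c i) * (dite _ _ _) = _
    rw [dif_pos hi, mul_div_cancel₀ _ (sub_ne_zero.2 (Ne.symm hi))]
  · change (c (i + 1) * c (i + 2) - 1) * (dite _ _ _) = _
    have h : c (i + 1) * c (i + 2) - 1 ≠ 0 := fun h => hi (by
      have := hc i
      rwa [sub_eq_zero.1 h, mul_one] at this)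
    rw [dif_pos hi, mul_div_cancel₀ _ h]
  · change (if i = j then 0 else (c j - c i) * (dite _ _ _)) = _
    have h : i ≠ j := fun h => hij (congrArg c h)
    rw [if_neg h, dif_pos hij, mul_div_cancel₀ _ (sub_ne_zero.2 (Ne.symm hij))]

end ComplexOctonion

/-! ### Polynomial functions -/

namespace AffineVar

variable {W W' : Type*} [AddCommGroup W] [Module ℂ W] [AddCommGroup W'] [Module ℂ W']

theorem dual_mem_polyFun (l : Module.Dual ℂ W) : (fun w => l w) ∈ polyFun W :=
  Algebra.subset_adjoin ⟨l, rfl⟩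

theorem const_mem_polyFun (c : ℂ) : (fun _ => c) ∈ polyFun W := (polyFun W).algebraMap_mem c

theorem restrict_mem_coordRing {p : W → ℂ} (hp : p ∈ polyFun W) (X : Set W) :
    (fun x : X => p x) ∈ coordRing X := by
  let F : (W → ℂ) →ₐ[ℂ] (X → ℂ) := AlgHom.pi fun x => Pi.evalAlgHom ℂ _ (x : W)
  have : polyFun W ≤ (coordRing X).comap F := by
    refine Algebra.adjoin_le ?_
    rintro _ ⟨l, rfl⟩
    exact mem_coordRing_dual X l
  exact this hp

theorem bilin_mem_polyFun [FiniteDimensional ℂ W] (β : W →ₗ[ℂ] W →ₗ[ℂ] ℂ) :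
    (fun w => β w w) ∈ polyFun W := by
  let b := Module.finBasis ℂ W
  have h : (fun w => β w w) = ∑ i, (fun w => b.coord i w) * fun w => β (b i) w := by
    funext w
    rw [Finset.sum_apply]
    have h1 := congrArg (fun u => β u w) (b.sum_repr w)
    simp only [map_sum, LinearMap.sum_apply, map_smul, LinearMap.smul_apply] at h1
    exact h1.symm
  rw [h]
  exact Subalgebra.sum_mem _ fun i _ =>
    Subalgebra.mul_mem _ (dual_mem_polyFun (b.coord i)) (dual_mem_polyFun (β (b i)))

end AffineVar

theorem WithBot.le_six_of_add_one_le {x : WithBot ℕ∞} (h : x + 1 ≤ (7 : ℕ)) : x ≤ 6 := by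
  induction x with
  | bot => exact bot_le
  | coe x =>
    have h1 : x + 1 ≤ 6 + 1 := WithBot.coe_le_coe.1 (h.trans_eq rfl)
    exact WithBot.coe_le_coe.2 ((ENat.add_le_add_iff_right (k := 1) ENat.one_ne_top).1 h1)

namespace ComplexOctonion

/-! ### The quadric -/

/-- The coordinates of an imaginary octonion. -/
noncomputable def imEquiv : V ≃ₗ[ℂ] (ZMod 7 → ℂ) where
  toFun v := v.1.im
  map_add' _ _ := rfl
  map_smul' _ _ := rfl
  invFun u := ⟨mk 0 u, rfl⟩
  left_inv v := Subtype.ext (ext v.2.symm fun _ => rfl)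
  right_inv _ := rfl

/-- The standard basis of the space of imaginary octonions. -/
noncomputable def imBasis : Module.Basis (ZMod 7) ℂ V := Module.Basis.ofEquivFun imEquiv

theorem imBasis_coord (i : ZMod 7) (v : V) : imBasis.coord i v = v.1.im i := rfl

theorem n_eq_sum (v : V) : n v = ∑ i, v.1.im i ^ 2 := by
  have h0 : v.1.re = 0 := v.2
  rw [n_eq, form_eq, sum_seven, h0]; ring

/-- The quadric is a hypersurface in a 7-dimensional space. Conversely it projects onto ℂ⁶ by
forgetting the e₀-coordinate, since that coordinate can be found as a square root. -/
theorem dim_quadric : dim quadric = 6 := by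
  refine le_antisymm (WithBot.le_six_of_add_one_le ?_) ?_
  · have h := dim_add_one_le imBasis quadric (∑ i, MvPolynomial.X i ^ 2 - MvPolynomial.C 3) ?_ ?_
    · rwa [Nat.card_zmod] at h
    · intro h
      have := congrArg (MvPolynomial.eval 0) h
      norm_num at this
    · intro v hv
      have h3 : n v = 3 := hv
      rw [n_eq_sum] at h3
      rw [map_sub, map_sum, MvPolynomial.eval_C]
      simp only [map_pow, MvPolynomial.eval_X, imBasis_coord]
      rw [h3, sub_self]
  · have h := natCard_le_dim (ι := {i : ZMod 7 // i ≠ 0}) quadric (fun i => imBasis.coord i) 0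
      (Filter.Eventually.of_forall fun w => ?_)
    · rw [Nat.card_eq_fintype_card] at h
      exact h
    · obtain ⟨s, hs⟩ : ∃ s : ℂ, s ^ 2 = 3 - ∑ i, w i ^ 2 :=
        ⟨_, Complex.cpow_nat_inv_pow _ two_ne_zero⟩
      let u : ZMod 7 → ℂ := fun i => if h : i ≠ 0 then w ⟨i, h⟩ else s
      refine ⟨⟨mk 0 u, rfl⟩, ?_, fun i => dif_pos i.2⟩
      change n (⟨mk 0 u, rfl⟩ : V).1 = 3
      rw [n_eq_sum]
      change ∑ i, u i ^ 2 = 3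
      rw [Fintype.sum_eq_add_sum_subtype_ne _ 0]
      have h1 : ∀ i : {i : ZMod 7 // i ≠ 0}, u i = w i := fun i => dif_pos i.2
      have h2 : u 0 = s := dif_neg (by simp)
      simp only [h1, h2, hs]
      ring

/-! ### The class as the image of a quadratic map with a linear inverse -/

/-- The bilinear form `⟨·, ·⟩`. -/
noncomputable def formL : ComplexOctonion →ₗ[ℂ] ComplexOctonion →ₗ[ℂ] ℂ :=
  LinearMap.mk₂ ℂ form form_add_left form_smul_left form_add_right
    fun c x y => form_smul_right c x y

theorem n_comp_mem_polyFun {W : Type*} [AddCommGroup W] [Module ℂ W] [FiniteDimensional ℂ W]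
    (ψ : W →ₗ[ℂ] ComplexOctonion) : (fun w => n (ψ w)) ∈ polyFun W :=
  bilin_mem_polyFun (formL.compl₁₂ ψ ψ)

/-- The endomorphism `q ↦ (q + vq - qv - (vq)v) / 4`. -/
noncomputable def conjPoly (v : ComplexOctonion) : Module.End ℂ ComplexOctonion :=
  (1 / 4 : ℂ) • (1 + LinearMap.mul ℂ ComplexOctonion v - (LinearMap.mul ℂ ComplexOctonion).flip v
    - (LinearMap.mul ℂ ComplexOctonion).flip v * LinearMap.mul ℂ ComplexOctonion v)

theorem toEnd_rot (v : quadric) : toEnd (rot v) = conjPoly v.1 := by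
  refine LinearMap.ext fun q => ?_
  rw [toEnd_apply, rot_apply, add_mul, sub_add_eq_sub_sub]
  rfl

/-- The parameter `ψ` serves two purposes: the inclusion of V gives regularity of the map, and the
axis of an endomorphism gives equations for the class. -/
theorem dual_conjPoly_mem_polyFun {W : Type*} [AddCommGroup W] [Module ℂ W]
    [FiniteDimensional ℂ W] (ψ : W →ₗ[ℂ] ComplexOctonion)
    (l : Module.Dual ℂ (Module.End ℂ ComplexOctonion)) :
    (fun w => l (conjPoly (ψ w))) ∈ polyFun W := by
  let β : W →ₗ[ℂ] W →ₗ[ℂ] ℂ :=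
    (((LinearMap.mul ℂ (Module.End ℂ ComplexOctonion)).compl₁₂
      ((LinearMap.mul ℂ ComplexOctonion).flip ∘ₗ ψ)
      (LinearMap.mul ℂ ComplexOctonion ∘ₗ ψ)).compr₂ l)
  have h : (fun w => l (conjPoly (ψ w))) = (1 / 4 : ℂ) • ((fun _ => l 1)
      + (fun w => (l ∘ₗ LinearMap.mul ℂ ComplexOctonion ∘ₗ ψ) w)
      - (fun w => (l ∘ₗ (LinearMap.mul ℂ ComplexOctonion).flip ∘ₗ ψ) w) - fun w => β w w) := by
    funext w
    rw [conjPoly, map_smul, map_sub, map_sub, map_add]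
    rfl
  rw [h]
  exact Subalgebra.smul_mem _ (Subalgebra.sub_mem _ (Subalgebra.sub_mem _ (Subalgebra.add_mem _
    (const_mem_polyFun _) (dual_mem_polyFun _)) (dual_mem_polyFun _)) (bilin_mem_polyFun β)) _

/-- The linear map that recovers `v` from `T_{a(v)}`. -/
noncomputable def axis : Module.End ℂ ComplexOctonion →ₗ[ℂ] V :=
  imEquiv.symm.toLinearMap ∘ₗ
    { toFun := fun S k => (S (e (k + 1))).im (k + 3) - (S (e (k + 3))).im (k + 1)
      map_add' := fun S S' => by
        funext k
        simp only [LinearMap.add_apply, im_add, Pi.add_apply]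
        ring
      map_smul' := fun c S => by
        funext k
        simp only [LinearMap.smul_apply, im_smul, Pi.smul_apply, smul_eq_mul, RingHom.id_apply]
        ring }

theorem axis_toEnd_rot (v : quadric) : axis (toEnd (rot v)) = v.1 := by
  apply imEquiv.injective
  funext k
  exact (im_eq_rot v k).symm

theorem isZariskiClosed_quadric : IsZariskiClosed quadric := by
  refine ⟨{fun v => n (V.subtype v) - 3}, ?_, ?_⟩
  · rintro _ rfl
    exact Subalgebra.sub_mem _ (n_comp_mem_polyFun V.subtype) (const_mem_polyFun 3)
  · ext v
    simp only [Set.mem_singleton_iff, forall_eq, Set.mem_ofPred_eq, sub_eq_zero]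
    rfl

/-- One inclusion is equivariance, the other is transitivity on the quadric. -/
theorem mem_carrier_mk_rot (v₀ : quadric) (g : G₂) :
    g ∈ (ConjClasses.mk (rot v₀)).carrier ↔ ∃ v, rot v = g := by
  rw [ConjClasses.mem_carrier_iff_mk_eq, ConjClasses.mk_eq_mk_iff_isConj]
  constructor
  · intro h
    obtain ⟨k, hk⟩ := isConj_iff.1 h.symm
    exact ⟨actQuadric k v₀, by rw [rot_actQuadric, hk]⟩
  · rintro ⟨v, rfl⟩
    obtain ⟨k, rfl⟩ := exists_actQuadric_eq v₀ v
    rw [rot_actQuadric]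
    exact (isConj_iff.2 ⟨k, rfl⟩).symm

theorem mem_classVariety_mk_rot (v₀ : quadric) (S : Module.End ℂ ComplexOctonion) :
    S ∈ classVariety (ConjClasses.mk (rot v₀)) ↔ ∃ v, toEnd (rot v) = S := by
  constructor
  · rintro ⟨g, hg, rfl⟩
    obtain ⟨v, rfl⟩ := (mem_carrier_mk_rot v₀ g).1 hg
    exact ⟨v, rfl⟩
  · rintro ⟨v, rfl⟩
    exact ⟨_, (mem_carrier_mk_rot v₀ _).2 ⟨v, rfl⟩, rfl⟩

/-- An endomorphism lies in the class exactly when its axis has norm 3 and it equals the quadratic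
expression in its axis. The second condition is tested by all linear forms. -/
theorem isZariskiClosed_classVariety_mk_rot (v₀ : quadric) :
    IsZariskiClosed (classVariety (ConjClasses.mk (rot v₀))) := by
  let ψ : Module.End ℂ ComplexOctonion →ₗ[ℂ] ComplexOctonion := V.subtype ∘ₗ axis
  refine ⟨insert (fun S => n (ψ S) - 3)
    (Set.range fun (l : Module.Dual ℂ (Module.End ℂ ComplexOctonion)) S =>
      l S - l (conjPoly (ψ S))), ?_, ?_⟩
  · rintro _ (rfl | ⟨l, rfl⟩)
    · exact Subalgebra.sub_mem _ (n_comp_mem_polyFun ψ) (const_mem_polyFun 3)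
    · exact Subalgebra.sub_mem _ (dual_mem_polyFun l) (dual_conjPoly_mem_polyFun ψ l)
  · ext S
    rw [mem_classVariety_mk_rot]
    constructor
    · rintro ⟨v, rfl⟩ _ (rfl | ⟨l, rfl⟩)
      · change n (axis _).1 - 3 = 0
        rw [axis_toEnd_rot, sub_eq_zero]
        exact v.2
      · change l _ - l (conjPoly (axis _).1) = 0
        rw [axis_toEnd_rot, toEnd_rot, sub_self]
    · intro h
      have h3 : n (axis S).1 = 3 := sub_eq_zero.1 (h _ (Set.mem_insert _ _))
      refine ⟨⟨axis S, h3⟩, ?_⟩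
      rw [toEnd_rot, eq_comm, ← sub_eq_zero, ← Module.forall_dual_apply_eq_zero_iff ℂ]
      intro l
      rw [map_sub]
      exact h _ (Set.mem_insert_of_mem _ ⟨l, rfl⟩)

/-- The bijection `v ↦ T_{a(v)}` of the quadric onto a conjugacy class. -/
noncomputable def rotEquiv (v₀ : quadric) :
    quadric ≃ classVariety (ConjClasses.mk (rot v₀)) where
  toFun v := ⟨toEnd (rot v), (mem_classVariety_mk_rot v₀ _).2 ⟨v, rfl⟩⟩
  invFun S := ⟨axis S.1, by
    obtain ⟨v, hv⟩ := (mem_classVariety_mk_rot v₀ _).1 S.2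
    rw [← hv, axis_toEnd_rot]
    exact v.2⟩
  left_inv v := Subtype.ext (axis_toEnd_rot v)
  right_inv S := by
    obtain ⟨v, hv⟩ := (mem_classVariety_mk_rot v₀ _).1 S.2
    refine Subtype.ext ?_
    rw [← hv]
    dsimp only
    congr 2
    refine Subtype.ext ?_
    exact (congrArg axis hv.symm).trans (axis_toEnd_rot v)

theorem isIso_rotEquiv (v₀ : quadric) : IsIso (rotEquiv v₀) := by
  constructor
  · refine isRegular_of_dual _ fun l => ?_
    have h := restrict_mem_coordRing (dual_conjPoly_mem_polyFun V.subtype l) quadric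
    have h1 : (fun v : quadric => l (rotEquiv v₀ v)) = fun v : quadric => l (conjPoly v.1) :=
      funext fun v => congrArg l (toEnd_rot v)
    rw [h1]
    exact h
  · exact isRegular_of_dual _ fun l => mem_coordRing_dual _ (l ∘ₗ axis)

/-! ### Uniqueness of the class -/

theorem rot_self (v : quadric) : (rot v).1 v.1 = v.1 := by
  have h : (v : V).1 * (v : V).1 = (-3 : ℂ) • 1 := by
    have h3 : n (v : V).1 = 3 := v.2
    rw [mul_self_of_mem_V v.1.2, h3]
  rw [rot_apply, add_mul, h, smul_mul_assoc, one_mul]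
  module

/-- On the first vectors e₀ acts by -i from the left and by i from the right. For v = (2ζ + 1)i e₀
both 1 + v and 1 - v therefore act as 2 + 2ζ, and (1 + ζ)² = ζ. -/
theorem rot_basePoint_apply {ζ : ℂ} (h1 : ζ ^ 2 + ζ + 1 = 0)
    (hc : ((2 * ζ + 1) * Complex.I) ^ 2 = 3) (z : Zorn) :
    (rot (basePoint _ hc)).1 (zorn z) = zorn (diagMap (fun _ => ζ) z) := by
  have hc0 : (2 * ζ + 1) * Complex.I ≠ 0 := by
    intro h; rw [h] at hc; norm_num at hc
  refine (map_zorn_eq_diagMap ?_ (fun _ => ζ) fun i => ?_).2 z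
  · have h := rot_self (basePoint _ hc)
    change (rot (basePoint _ hc)).1 (((2 * ζ + 1) * Complex.I) • e 0)
      = ((2 * ζ + 1) * Complex.I) • e 0 at h
    rw [map_smul] at h
    exact smul_right_injective _ hc0 h
  · generalize (Pi.single i 1 : Fin 3 → ℂ) = x
    have hl : e 0 * zorn (zornVec x) = (-Complex.I) • zorn (zornVec x) := by
      rw [e_zero_eq_zorn, ← zorn_zmul, ← map_smul]
      congr 1
      rw [zorn_ext_iff]
      simp [zmul, zornVec_apply]
    have hr : zorn (zornVec x) * e 0 = Complex.I • zorn (zornVec x) := by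
      rw [e_zero_eq_zorn, ← zorn_zmul, ← map_smul]
      congr 1
      rw [zorn_ext_iff]
      simp [zmul, zornVec_apply]
    rw [rot_apply]
    change (1 / 4 : ℂ) • ((zorn (zornVec x) + (((2 * ζ + 1) * Complex.I) • e 0) * zorn (zornVec x))
      - (zorn (zornVec x) + (((2 * ζ + 1) * Complex.I) • e 0) * zorn (zornVec x))
        * (((2 * ζ + 1) * Complex.I) • e 0)) = _
    simp only [smul_mul_assoc, hl, add_mul, mul_smul_comm, hr]
    match_scalars
    linear_combination
      (-(2 * ζ + 1) * (3 + 2 * ζ - (2 * ζ + 1) * Complex.I ^ 2) / 4) * Complex.I_sq + h1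

theorem eq_mk_rot_of_dim_eq_six (v₀ : quadric) (C : ConjClasses G₂) (hC : IsSemisimpleClass C)
    (hdim : dim (classVariety C) = 6) : C = ConjClasses.mk (rot v₀) := by
  obtain ⟨g, rfl⟩ := C.exists_rep
  obtain ⟨v, hv⟩ := exists_fixed_quadric (hC g ConjClasses.mem_carrier_mk)
  obtain ⟨c₀, hc₀⟩ : ∃ c : ℂ, c ^ 2 = 3 := ⟨_, Complex.cpow_nat_inv_pow 3 two_ne_zero⟩
  have hc0 : c₀ ≠ 0 := by rintro rfl; norm_num at hc₀
  obtain ⟨h, hh⟩ := exists_map_eq_basePoint v c₀ hc₀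
  have hmk : ConjClasses.mk (h * g * h⁻¹) = ConjClasses.mk g :=
    ConjClasses.mk_eq_mk_iff_isConj.2 (isConj_iff.2 ⟨h, rfl⟩).symm
  have hss : (toEnd (h * g * h⁻¹)).IsSemisimple := hC _ (ConjClasses.mem_carrier_iff_mk_eq.2 hmk)
  have hfix : (h * g * h⁻¹).1 (e 0) = e 0 := by
    have h1 : h.1 v.1 = c₀ • e 0 := congrArg (fun r : quadric => r.1.1) hh
    have h2 : g.1 v.1 = v.1 := congrArg (fun r : quadric => r.1.1) hv
    have h3 : (h⁻¹).1 (c₀ • e 0) = v.1 := by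
      rw [← h1]
      exact h.1.symm_apply_apply _
    have h4 : (h * g * h⁻¹).1 (c₀ • e 0) = c₀ • e 0 := by
      rw [mul_apply_G₂, mul_apply_G₂, h3, h2, h1]
    rw [map_smul] at h4
    exact smul_right_injective _ hc0 h4
  obtain ⟨k, c, hc1, hc⟩ := exists_conj_diagMap hss hfix
  have hmk' : ConjClasses.mk (k⁻¹ * (h * g * h⁻¹) * k) = ConjClasses.mk g := by
    rw [← hmk]
    exact ConjClasses.mk_eq_mk_iff_isConj.2 (isConj_iff.2 ⟨k⁻¹, by rw [inv_inv]⟩).symm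
  rw [← hmk'] at hdim ⊢
  generalize k⁻¹ * (h * g * h⁻¹) * k = d at *
  -- Equal entries are a cube root of unity: 1 gives a class of dimension 0, a primitive root gives
  -- a rotation. In all other cases the dimension is at least 7.
  by_cases hne : c 0 = c 1 ∧ c 0 = c 2
  · have hconst : c = fun _ => c 0 := by
      funext i
      fin_cases i
      exacts [rfl, hne.1.symm, hne.2.symm]
    rw [← hne.1, ← hne.2] at hc1
    rw [hconst] at hc
    generalize c 0 = ζ at *
    by_cases hζ : ζ = 1
    · exfalso
      have hd : d = 1 := by
        refine Subtype.ext (LinearEquiv.ext fun q => ?_)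
        obtain ⟨z, rfl⟩ := zorn.surjective q
        rw [hc]
        simp [diagMap, hζ]
      have hset : classVariety (ConjClasses.mk d) = {toEnd 1} := by
        ext S
        simp only [classVariety, Set.mem_image, Set.mem_singleton_iff, hd,
          ConjClasses.mem_carrier_iff_mk_eq, ConjClasses.mk_eq_mk_iff_isConj, isConj_one_left]
        simp [eq_comm]
      rw [hset, dim_singleton] at hdim
      norm_num at hdim
    · have h1 : ζ ^ 2 + ζ + 1 = 0 := by
        refine (mul_eq_zero.1 (?_ : (ζ - 1) * (ζ ^ 2 + ζ + 1) = 0)).resolve_left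
          (sub_ne_zero.2 hζ)
        linear_combination hc1
      have h3 : ((2 * ζ + 1) * Complex.I) ^ 2 = 3 := by
        linear_combination (2 * ζ + 1) ^ 2 * Complex.I_sq - 4 * h1
      have hd : d = rot (basePoint _ h3) := by
        refine Subtype.ext (LinearEquiv.ext fun q => ?_)
        obtain ⟨z, rfl⟩ := zorn.surjective q
        rw [hc, rot_basePoint_apply h1 h3]
      rw [hd]
      exact ConjClasses.mem_carrier_iff_mk_eq.1 ((mem_carrier_mk_rot v₀ _).2 ⟨_, rfl⟩)
  · exfalso
    have h7 := seven_le_dim_classVariety hc1 hne hc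
    rw [hdim] at h7
    exact absurd h7 (by norm_num)

end ComplexOctonion

theorem mainTheorem6 :
    ∃ φ : quadric → G₂,
      -- the map is `v ↦ T_{a(v)}`
      (∀ (v : quadric) (q : ComplexOctonion),
        (φ v : ComplexOctonion ≃ₗ[ℂ] ComplexOctonion) q = T (a (v : V)) q) ∧
      -- equivariance, where `G₂` acts on the quadric as a subset of `V` and on itself by conjugation
      (∀ (g : G₂) (v : quadric), ∃ w : quadric,
        ((w : V) : ComplexOctonion)
            = (g : ComplexOctonion ≃ₗ[ℂ] ComplexOctonion) ((v : V) : ComplexOctonion) ∧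
          φ w = g * φ v * g⁻¹) ∧
      -- the unique semisimple class of dimension six, and the isomorphism onto it
      ∃ C : ConjClasses G₂,
        (IsSemisimpleClass C ∧ dim (classVariety C) = 6) ∧
        (∀ C' : ConjClasses G₂,
          IsSemisimpleClass C' ∧ dim (classVariety C') = 6 → C' = C) ∧
        IsZariskiClosed quadric ∧ IsZariskiClosed (classVariety C) ∧
        ∃ f : quadric ≃ classVariety C,
          (∀ v : quadric, (f v : Module.End ℂ ComplexOctonion) = toEnd (φ v)) ∧
          IsIso f := by
  obtain ⟨c, hc⟩ : ∃ c : ℂ, c ^ 2 = 3 := ⟨_, Complex.cpow_nat_inv_pow 3 two_ne_zero⟩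
  let v₀ := basePoint c hc
  refine ⟨rot, rot_apply_eq_T, fun g v => ⟨actQuadric g v, rfl, rot_actQuadric g v⟩,
    ConjClasses.mk (rot v₀), ⟨fun g hg => ?_, ?_⟩,
    fun C' hC' => eq_mk_rot_of_dim_eq_six v₀ C' hC'.1 hC'.2, isZariskiClosed_quadric,
    isZariskiClosed_classVariety_mk_rot v₀, rotEquiv v₀, fun v => rfl, isIso_rotEquiv v₀⟩
  · obtain ⟨v, rfl⟩ := (mem_carrier_mk_rot v₀ g).1 hg
    exact isSemisimple_toEnd_rot v
  · rw [← (isIso_rotEquiv v₀).dim_eq, dim_quadric]
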